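/- Let $\Omega\subset\mathbb R^3$ be a bounded open set with $\Omega=\operatorname{int}\overline\Omega$ (for example a bounded Lipschitz domain), and let $\mathcal T$ be a finite simplicial complex whose underlying space is $\overline\Omega$. A *primal cell* is a (closed) tetrahedron $T$ of $\mathcal T$. For a primal cell $T$ and a vertex $N$ of $T$ let $K=K(T,N)$ be the hexahedron whose eight vertices are the barycentres of the faces (of dimension $0,1,2,3$) of $T$ that contain $N$; let $\mathcal K$ be the set of all these hexahedra. The *dual cell* of a node $N$ is $\widetilde T_N=\bigcup_{T\ni N}K(T,N)$, so that $K(T,N)=T\cap\widetilde T_N$. For each $K=K(T,N)$ number the other three vertices of $T$ as $v_1,v_2,v_3$ (arbitrarily), and let $\mathbf F_K:\widehat K=[-1,1]^3\to K$ be the trilinear map that sends the cube vertex with coordinates $+1$ on the axes $i\in\sigma$ and $-1$ on the others to the barycentre of $\{N\}\cup\{v_i:i\in\sigma\}$, for every $\sigma\subseteq\{1,2,3\}$. Let $\mathbf J_K$ be its Jacobian matrix; a reference field $\widehat{\boldsymbol v}$ on $\widehat K$ is mapped to $K$ by the covariant Piola transform $\boldsymbol v\circ\mathbf F_K=\mathbf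 J_K^{-T}\widehat{\boldsymbol v}$. Let $P\ge1$, let $-1=\xi_0<\dots<\xi_P<1$ be the Gauss–Radau points of $[-1,1]$ (the quadrature rule on them, with suitable weights, is exact for polynomials of degree at most $2P$), let $\ell_0,\dots,\ell_P$ be the Lagrange interpolation polynomials on these points, and put $\ell_\alpha(\hat x)=\ell_{\alpha_1}(\hat x_1)\ell_{\alpha_2}(\hat x_2)\ell_{\alpha_3}(\hat x_3)$ for $\alpha\in\{0,\dots,P\}^3$. *Basis on the dual mesh.* A function $\boldsymbol E_n$ is given by a node $N$, a simplex $F$ of $\mathcal T$ with $N\in F$ (a tetrahedron, triangle or edge: cell-, face- or edge-centred function), a vertex $w\ne N$ of $F$, and degrees $a_v\in\{0,\dots,P\}$ for the vertices $v\neq N$ of $F$, with $a_v\neq0$ for $v\ne w$. On each $K(T,N)$ with $F\subseteq T$ it is the Piola transform of $\ell_\alpha(\hat{\mathbf x})\,\hat{\mathbf e}_i$, where $v_i=w$, and $\alpha_j=a_{v_j}$ if $v_j\in F$ and $\alpha_j=0$ otherwise; on all other hexahedra it is $0$. *Basis on the primal mesh.* A function $\boldsymbol H_{\tilde n}$ is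 given by a tetrahedron $T$, a nonempty set $M$ of vertices of $T$, a vertex $w\notin M$ of $T$, and degrees $a_v\in\{0,\dots,P\}$ for the vertices $v\notin M$ of $T$, with $a_v\ne0$ for $v\neq w$ (cell-, face- and edge-centred for $|M|=1,2,3$). On each $K(T,N)$ with $N\in M$ it is the Piola transform of $\ell_\alpha(-\hat{\mathbf x})\,\hat{\mathbf e}_i$, where $v_i=w$, and $\alpha_j=a_{v_j}$ if $v_j\notin M$ and $\alpha_j=0$ otherwise; on all other hexahedra it is $0$. With $\mathbf n$ the outward unit normal to $\partial K$, with one-sided traces from $K$ in the boundary terms, and for $K=K(T,N)$ with $$\partial K_{\mathcal T}=\partial K\cap\partial T,\qquad \partial K_{\widetilde{\mathcal T}}=(\partial K\cap\partial\widetilde T_N)\setminus\partial\Omega ,$$ define $$\widetilde c_{n\tilde n}=\sum_{K\in\mathcal K}\Big(-\int_{\partial K_{\widetilde{\mathcal T}}}\boldsymbol E_n\times\boldsymbol H_{\tilde n}\cdot\mathbf n\,dS+\int_K\operatorname{curl}\boldsymbol E_n\cdot\boldsymbol H_{\tilde n}\,dV\Big),$$ $$c_{\tilde nn}=\sum_{K\in\mathcal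 K}\Big(-\int_{\partial K_{\mathcal T}}\boldsymbol H_{\tilde n}\times\boldsymbol E_n\cdot\mathbf n\,dS+\int_K\operatorname{curl}\boldsymbol H_{\tilde n}\cdot\boldsymbol E_n\,dV\Big).$$ Then all these integrals converge, and: 1. $\widetilde c_{n\tilde n}=c_{\tilde nn}$ for all $n,\tilde n$, that is, $\widetilde{\mathbf C}=\mathbf C^{T}$. 2. Each $\boldsymbol E_n$ is supported in the single dual cell $\widetilde T_N$ of its node, and each $\boldsymbol H_{\tilde n}$ in the single primal cell $T$ of its tetrahedron. 3. $\mathbf C$ is sparse: $c_{\tilde nn}=0$ whenever the primal cell of $\tilde n$ and the dual cell of $n$ are disjoint. Each row of $\mathbf C$ has at most $12(P+1)^3$ nonzero entries, and the column of $n$ has at most $3(P+1)^3$ times the number of tetrahedra at the node of $n$. -/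

import Mathlib

open MeasureTheory Set
open scoped Matrix Polynomial

namespace DualCell

noncomputable section

/-- Points and vectors of `ℝ³`, in coordinates. -/
abbrev R3 : Type := Fin 3 → ℝ

/-- The classical curl of a vector field on `ℝ³`. -/
def curl (v : R3 → R3) (x : R3) : R3 :=
  let D : Fin 3 → Fin 3 → ℝ := fun j i => fderiv ℝ v x (Pi.single j 1) i
  ![D 1 2 - D 2 1, D 2 0 - D 0 2, D 0 1 - D 1 0]

/-- The reference cube `[-1, 1]³`. -/
def refCube : Set R3 := Icc (-1) 1

/-! ### Gauss-Radau interpolation -/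

/-- `ξ 0 < ⋯ < ξ P` are the `P + 1` Gauss-Radau quadrature points of `[-1, 1]` that include the
left end point: the quadrature rule on these points (with suitable weights) is exact for all
polynomials of degree at most `2 P`. -/
structure IsGaussRadau (P : ℕ) (ξ : Fin (P + 1) → ℝ) : Prop where
  strictMono : StrictMono ξ
  left : ξ 0 = -1
  lt_one : ∀ a, ξ a < 1
  exact : ∃ w : Fin (P + 1) → ℝ, ∀ p : ℝ[X], p.natDegree ≤ 2 * P →
    ∫ x in (-1 : ℝ)..1, p.eval x = ∑ a, w a * p.eval (ξ a)

/-- The tensor-product interpolation polynomial `ℓ_α(x) = ℓ_{α₀}(x₀) ℓ_{α₁}(x₁) ℓ_{α₂}(x₂)`. -/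
def ell {P : ℕ} (ξ : Fin (P + 1) → ℝ) (α : Fin 3 → Fin (P + 1)) (x : R3) : ℝ :=
  ∏ j, (Lagrange.basis Finset.univ ξ (α j)).eval (x j)

/-! ### The primal mesh, its barycentric dual, and the hexahedral subcells -/

/-- The barycentre of a finite set of points. -/
def bary (s : Finset R3) : R3 := (s.card : ℝ)⁻¹ • ∑ v ∈ s, v

/-- A pair (tetrahedron `T` of the mesh, vertex `N` of `T`). These pairs index the hexahedra
`K = T ∩ T̃`, with `T` a primal cell and `T̃` the dual cell of `N`; this intersection is
empty when `N` is not a vertex of `T`. -/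
structure Subcell (S : Geometry.SimplicialComplex ℝ R3) where
  cell : Finset R3
  cell_mem : cell ∈ S.faces
  cell_card : cell.card = 4
  node : R3
  node_mem : node ∈ cell

variable {S : Geometry.SimplicialComplex ℝ R3}

instance [Finite S.faces] : Finite (Subcell S) :=
  Finite.of_injective
    (β := Σ s : S.faces, {v : R3 // v ∈ s.1})
    (fun K => ⟨⟨K.cell, K.cell_mem⟩, ⟨K.node, K.node_mem⟩⟩) (by
      rintro ⟨T, hT, hc, N, hN⟩ ⟨T', hT', hc', N', hN'⟩ h
      simp only [Sigma.mk.injEq, Subtype.mk.injEq] at h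
      obtain ⟨rfl, h⟩ := h
      simp only [heq_eq_eq, Subtype.mk.injEq] at h
      subst h
      rfl)

instance [Finite S.faces] : Fintype (Subcell S) := Fintype.ofFinite _

/-- The hexahedron `K`: its eight vertices are the barycentres of the faces of `T` (of dimension
`0, …, 3`) that contain `N`. -/
def Subcell.hex (K : Subcell S) : Set R3 :=
  convexHull ℝ {b | ∃ s : Finset R3, s ⊆ K.cell ∧ K.node ∈ s ∧ b = bary s}

/-- The dual cell of the node `N`: the union of the hexahedra at `N`. -/
def dualCell (S : Geometry.SimplicialComplex ℝ R3) (N : R3) : Set R3 :=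
  ⋃ K ∈ {K : Subcell S | K.node = N}, K.hex

/-- For every hexahedron `K = (T, N)`, a numbering of the three vertices of `T` other than `N`
by the three axes of the reference cube. -/
abbrev AxisLabelling (S : Geometry.SimplicialComplex ℝ R3) : Type :=
  ∀ K : Subcell S, Fin 3 ≃ {v : R3 // v ∈ K.cell ∧ v ≠ K.node}

variable (ν : AxisLabelling S) (K : Subcell S)

open Classical in
/-- The vertex of `K` that corresponds to the vertex of the reference cube with coordinates `1` on
the axes in `σ` and `-1` on the others. In particular `(-1,-1,-1)` corresponds to the node `N` and
`(1,1,1)` to the barycentre of `T`. -/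
def hexVertex (σ : Finset (Fin 3)) : R3 :=
  bary (insert K.node (σ.image fun i => (ν K i : R3)))

/-- The trilinear map `F_K` from the reference cube onto `K`. -/
def trilinear (x : R3) : R3 :=
  ∑ σ : Finset (Fin 3),
    ((∏ i ∈ σ, (1 + x i) / 2) * ∏ i ∈ σᶜ, (1 - x i) / 2) • hexVertex ν K σ

/-- The Jacobian matrix `J_K` of `F_K`. -/
def jac (x : R3) : Matrix (Fin 3) (Fin 3) ℝ :=
  LinearMap.toMatrix' (fderiv ℝ (trilinear ν K) x : R3 →ₗ[ℝ] R3)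

/-- The covariant Piola transform `v = J_K^{-T} v̂` of a field on the reference cube, as a
field on `K`. -/
def piola (vhat : R3 → R3) (x : R3) : R3 :=
  let xhat := Function.invFunOn (trilinear ν K) refCube x
  ((jac ν K xhat)⁻¹)ᵀ *ᵥ vhat xhat

/-! ### The two bases -/

/-- Index set of the basis functions `E_n` on the dual mesh. The function is attached to the node
`N`, to a simplex of the mesh containing `N` (a tetrahedron, triangle or edge: cell-, face- or
edge-centred functions) and to a direction, the axis from `N` to another vertex `dir` of the
simplex. The index of the interpolation node on the axis towards a vertex of the simplex is
`deg`; it is nonzero on all axes but that of `dir`. -/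
structure EIndex (S : Geometry.SimplicialComplex ℝ R3) (P : ℕ) where
  node : R3
  simplex : Finset R3
  simplex_mem : simplex ∈ S.faces
  node_mem : node ∈ simplex
  dir : R3
  dir_mem : dir ∈ simplex
  dir_ne : dir ≠ node
  deg : {v : R3 // v ∈ simplex ∧ v ≠ node} → Fin (P + 1)
  deg_ne : ∀ v, v.1 ≠ dir → deg v ≠ 0

/-- Index set of the basis functions `H_ñ` on the primal mesh. The function is attached to a
tetrahedron `cell`, to a nonempty set `core` of vertices of it (one, two or three: the barycentric
dual, inside the tetrahedron, of the simplex spanned by `core` is a hexahedron, a quadrilateral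
between two hexahedra, or a segment common to three hexahedra: cell-, face- or edge-centred
functions) and to a direction, the axis towards a vertex `dir` outside `core`. The index of
the interpolation node on the axis towards a vertex outside `core` is `deg`; it is nonzero on all
axes but that of `dir`. -/
structure HIndex (S : Geometry.SimplicialComplex ℝ R3) (P : ℕ) where
  cell : Finset R3
  cell_mem : cell ∈ S.faces
  cell_card : cell.card = 4
  core : Finset R3
  core_subset : core ⊆ cell
  core_nonempty : core.Nonempty
  dir : R3
  dir_mem : dir ∈ cell
  dir_notMem : dir ∉ core
  deg : {v : R3 // v ∈ cell ∧ v ∉ core} → Fin (P + 1)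
  deg_ne : ∀ v, v.1 ≠ dir → deg v ≠ 0

variable {P : ℕ} (ξ : Fin (P + 1) → ℝ)

open Classical in
/-- The reference field `Ê_{n,K}`: it is `ℓ_α(x̂) ê_i` on the hexahedra at the node of `n` that lie
in a tetrahedron containing the simplex of `n`, and zero on all others. Here `i` is the axis of `K`
towards `dir`, and `α` is `deg` on the axes of `K` towards vertices of the simplex, `0` on the
others. -/
def EIndex.ref (n : EIndex S P) (x : R3) : R3 :=
  if K.node = n.node ∧ n.simplex ⊆ K.cell then
    fun i => if (ν K i : R3) = n.dir then
      ell ξ (fun j => if h : (ν K j : R3) ∈ n.simplex ∧ (ν K j : R3) ≠ n.node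
        then n.deg ⟨ν K j, h⟩ else 0) x
    else 0
  else 0

open Classical in
/-- The reference field `Ĥ_{ñ,K}`: it is `ℓ_α(-x̂) ê_i` on the hexahedra of the tetrahedron of `ñ`
whose node belongs to `core`, and zero on all others. Here `i` is the axis of `K` towards `dir`, and
`α` is `deg` on the axes of `K` towards vertices outside `core`, `0` on the others. -/
def HIndex.ref (m : HIndex S P) (x : R3) : R3 :=
  if K.cell = m.cell ∧ K.node ∈ m.core then
    fun i => if (ν K i : R3) = m.dir then
      ell ξ (fun j => if h : (ν K j : R3) ∈ m.cell ∧ (ν K j : R3) ∉ m.core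
        then m.deg ⟨ν K j, h⟩ else 0) (-x)
    else 0
  else 0

/-- The restriction of `E_n` to the hexahedron `K`. -/
def EIndex.field (n : EIndex S P) : R3 → R3 := piola ν K (n.ref ν K ξ)

/-- The restriction of `H_ñ` to the hexahedron `K`. -/
def HIndex.field (m : HIndex S P) : R3 → R3 := piola ν K (m.ref ν K ξ)

/-! ### Boundary terms -/

/-- The point of the face `x̂_i = s` of the reference cube with the other two coordinates `y`. -/
def facePoint (i : Fin 3) (s : ℝ) (y : Fin 2 → ℝ) : R3 := i.insertNth s y

/-- The density of `v · n dS` (`n` the outward unit normal to `∂K`, `dS` the area element of `∂K`)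
with respect to area on the face `x̂_i = s` of the reference cube, `s = ± 1`: the vector
`n dS` is `|det J_K| J_K^{-T} n̂`, where `n̂ = s ê_i` is the outward unit normal to the cube. -/
def fluxDensity (v : R3 → R3) (i : Fin 3) (s : ℝ) (y : Fin 2 → ℝ) : ℝ :=
  let xhat := facePoint i s y
  v (trilinear ν K xhat) ⬝ᵥ (|(jac ν K xhat).det| • (((jac ν K xhat)⁻¹)ᵀ *ᵥ Pi.single i s))

/-- The surface integral `∫_{∂K ∩ A} v · n dS`, in the parametrisation of `∂K` by the six faces
of the reference cube. -/
def flux (A : Set R3) (v : R3 → R3) : ℝ :=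
  ∑ i : Fin 3, ∑ s ∈ ({-1, 1} : Finset ℝ),
    ∫ y in {y : Fin 2 → ℝ | y ∈ Icc (-1) 1 ∧ trilinear ν K (facePoint i s y) ∈ A},
      fluxDensity ν K v i s y

/-- The part of `∂K` on the boundary of the primal cell containing `K`. -/
def primalBdry : Set R3 :=
  frontier K.hex ∩ frontier (convexHull ℝ (K.cell : Set R3))

/-- The part of `∂K` on the boundary of the dual cell containing `K`, the boundary of the domain
`Ω` excepted. -/
def dualBdry (Ω : Set R3) : Set R3 :=
  (frontier K.hex ∩ frontier (dualCell S K.node)) \ frontier Ω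

/-! ### The two discrete curl matrices -/

/-- The matrix `C̃`. -/
def curlE [Finite S.faces] (Ω : Set R3) : Matrix (EIndex S P) (HIndex S P) ℝ := fun n m =>
  ∑ K : Subcell S,
    (-flux ν K (dualBdry K Ω) (fun x => n.field ν K ξ x ⨯₃ m.field ν K ξ x)
      + ∫ x in K.hex, curl (n.field ν K ξ) x ⬝ᵥ m.field ν K ξ x)

/-- The matrix `C`. -/
def curlH [Finite S.faces] : Matrix (HIndex S P) (EIndex S P) ℝ := fun m n =>
  ∑ K : Subcell S,
    (-flux ν K (primalBdry K) (fun x => m.field ν K ξ x ⨯₃ n.field ν K ξ x)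
      + ∫ x in K.hex, curl (m.field ν K ξ) x ⬝ᵥ n.field ν K ξ x)

end

end DualCell

namespace DualCell

noncomputable section

/-! ### The trilinear map in barycentric coordinates -/

/-! The transpose identity holds hexahedron by hexahedron. Write û, ŵ for the reference fields of E
and H on K. Covariant Piola transforms make both curl E · H dV and (E × H) · n dS metric-free: on
the cube they become curl û · ŵ and (û × ŵ) · n̂, up to one common sign, the orientation of the
tetrahedron. The divergence theorem for û × ŵ on the cube then gives the difference of the two
volume terms as a flux through all six faces. The three faces x̂_i = 1 form, up to null sets, the
dual part of ∂K, and the three faces x̂_i = -1 the primal part, so each half of the flux is the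
boundary term of one matrix (`hex_term_eq`).

The geometry reduces to one fixed map. In an affine chart of T with N at the origin, `trilinear` is
`hexMap` for every K (`trilinear_eq`). Its Jacobian is strictly diagonally dominant with nonpositive
off-diagonal entries, which gives a positive determinant and injectivity on the cube; its image is
the set of points of T whose barycentric coordinate at N is largest (`hexMap_image_refCube`). Faces
are sorted by local arguments: a front point can leave the dual cell while staying inside T; a back
point can leave T, but unless it lies on ∂Ω the dual cell is a neighbourhood of it
(`chart_front_mem_dualBdry`, `chart_back_notMem_dualBdry`).

Sparsity is counting: a nonzero entry needs a hexahedron carrying both functions, and on a given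
hexahedron a basis function is determined by an axis and three degrees (`EIndex.injOn_code`,
`HIndex.injOn_code`). -/

/-- The coordinate `i` of the trilinear map, with `x i = a`, and `b`, `c` the other two
coordinates. -/
def hexCoord (a b c : ℝ) : ℝ :=
  (1 + a) / 2 * ((6 - (1 + b) - (1 + c) + (1 + b) * (1 + c) / 4) / 12)

/-- The trilinear map in the barycentric coordinates of the tetrahedron. -/
def hexMap (x : R3) : R3 :=
  ![hexCoord (x 0) (x 1) (x 2), hexCoord (x 1) (x 0) (x 2), hexCoord (x 2) (x 0) (x 1)]

/-- The Jacobian matrix of `hexMap`. -/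
def hexJac (x : R3) : Matrix (Fin 3) (Fin 3) ℝ :=
  let d : ℝ → ℝ → ℝ := fun b c => (6 - (1 + b) - (1 + c) + (1 + b) * (1 + c) / 4) / 24
  let o : ℝ → ℝ → ℝ := fun a c => (1 + a) / 2 * ((-1 + (1 + c) / 4) / 12)
  !![d (x 1) (x 2), o (x 0) (x 2), o (x 0) (x 1);
     o (x 1) (x 2), d (x 0) (x 2), o (x 1) (x 0);
     o (x 2) (x 1), o (x 2) (x 0), d (x 0) (x 1)]

lemma hasFDerivAt_hexCoord (i j k : Fin 3) (x : R3) :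
    HasFDerivAt (fun x : R3 => hexCoord (x i) (x j) (x k))
      (((6 - (1 + x j) - (1 + x k) + (1 + x j) * (1 + x k) / 4) / 24) •
          ContinuousLinearMap.proj (R := ℝ) (φ := fun _ : Fin 3 => ℝ) i
        + ((1 + x i) / 2 * ((-1 + (1 + x k) / 4) / 12)) •
          ContinuousLinearMap.proj (R := ℝ) (φ := fun _ : Fin 3 => ℝ) j
        + ((1 + x i) / 2 * ((-1 + (1 + x j) / 4) / 12)) •
          ContinuousLinearMap.proj (R := ℝ) (φ := fun _ : Fin 3 => ℝ) k) x := by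
  have h (i : Fin 3) : HasFDerivAt (fun x : R3 => 1 + x i)
      (ContinuousLinearMap.proj (R := ℝ) (φ := fun _ : Fin 3 => ℝ) i) x :=
    (hasFDerivAt_apply i x).const_add 1
  have := ((h i).mul_const (1/2)).mul
    (((((h j).const_sub 6).sub (h k)).add (((h j).mul (h k)).mul_const (1/4))).mul_const (1/12))
  refine (this.congr_fderiv ?_).congr_of_eventuallyEq (.of_forall fun x => ?_)
  · ext v
    simp
    ring
  · simp [hexCoord]
    ring

lemma hasFDerivAt_hexMap (x : R3) :
    HasFDerivAt hexMap (LinearMap.toContinuousLinearMap (Matrix.toLin' (hexJac x))) x := by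
  rw [hasFDerivAt_pi']
  intro i
  fin_cases i
  · refine (hasFDerivAt_hexCoord 0 1 2 x).congr_fderiv ?_
    ext v
    simp [hexJac, dotProduct, Fin.sum_univ_three]
  · refine (hasFDerivAt_hexCoord 1 0 2 x).congr_fderiv ?_
    ext v
    simp [hexJac, dotProduct, Fin.sum_univ_three]
    ring
  · refine (hasFDerivAt_hexCoord 2 0 1 x).congr_fderiv ?_
    ext v
    simp [hexJac, dotProduct, Fin.sum_univ_three]
    ring

lemma mem_refCube {x : R3} : x ∈ refCube ↔ ∀ i, -1 ≤ x i ∧ x i ≤ 1 := by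
  simp [refCube, Pi.le_def, forall_and]

lemma hexCoord_offDiag_nonpos {a c : ℝ} (ha : -1 ≤ a) (hc1 : c ≤ 1) :
    (1 + a) / 2 * ((-1 + (1 + c) / 4) / 12) ≤ 0 :=
  mul_nonpos_of_nonneg_of_nonpos (by linarith) (by linarith)

/-- The Jacobian matrix of the trilinear map is strictly diagonally dominant. -/
lemma hexCoord_rowSum_pos {a b c : ℝ} (ha1 : a ≤ 1) (hb1 : b ≤ 1) (hc1 : c ≤ 1) :
    0 < (6 - (1 + b) - (1 + c) + (1 + b) * (1 + c) / 4) / 24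
      + (1 + a) / 2 * ((-1 + (1 + c) / 4) / 12) + (1 + a) / 2 * ((-1 + (1 + b) / 4) / 12) := by
  -- With r = (1 + a)/2, s = (1 + b)/2, t = (1 + c)/2, the sum times 24 equals 1 + (1 - s)(1 - t) +
  -- (1 - r)(4 - s - t).
  nlinarith [mul_nonneg (sub_nonneg.2 hb1) (sub_nonneg.2 hc1),
    mul_nonneg (sub_nonneg.2 ha1) (by linarith : 0 ≤ 6 - b - c)]

/-- A strictly diagonally dominant `3 × 3` matrix with nonpositive off-diagonal entries has
positive determinant. -/
lemma det_pos_of_rowSum_pos {M : Matrix (Fin 3) (Fin 3) ℝ} (h : ∀ i j, i ≠ j → M i j ≤ 0)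
    (h' : ∀ i, 0 < M i 0 + M i 1 + M i 2) : 0 < M.det := by
  have h01 := h 0 1 (by decide)
  have h02 := h 0 2 (by decide)
  have h10 := h 1 0 (by decide)
  have h12 := h 1 2 (by decide)
  have h20 := h 2 0 (by decide)
  have h21 := h 2 1 (by decide)
  have h0 := h' 0
  have h1 := h' 1
  have h2 := h' 2
  rw [Matrix.det_fin_three]
  -- In terms of the row sums and the negated off-diagonal entries, the determinant is a polynomial
  -- with nonnegative coefficients, and it contains the product p q r of the row sums.
  obtain ⟨b, hb⟩ : ∃ b, b = -M 0 1 := ⟨_, rfl⟩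
  obtain ⟨c, hc⟩ : ∃ c, c = -M 0 2 := ⟨_, rfl⟩
  obtain ⟨d, hd⟩ : ∃ d, d = -M 1 0 := ⟨_, rfl⟩
  obtain ⟨f, hf⟩ : ∃ f, f = -M 1 2 := ⟨_, rfl⟩
  obtain ⟨g, hg⟩ : ∃ g, g = -M 2 0 := ⟨_, rfl⟩
  obtain ⟨k, hk⟩ : ∃ k, k = -M 2 1 := ⟨_, rfl⟩
  obtain ⟨p, hp⟩ : ∃ p, p = M 0 0 + M 0 1 + M 0 2 := ⟨_, rfl⟩
  obtain ⟨q, hq⟩ : ∃ q, q = M 1 0 + M 1 1 + M 1 2 := ⟨_, rfl⟩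
  obtain ⟨r, hr⟩ : ∃ r, r = M 2 0 + M 2 1 + M 2 2 := ⟨_, rfl⟩
  rw [show M 0 1 = -b by linarith, show M 0 2 = -c by linarith, show M 1 0 = -d by linarith,
    show M 1 2 = -f by linarith, show M 2 0 = -g by linarith, show M 2 1 = -k by linarith,
    show M 0 0 = p + b + c by linarith, show M 1 1 = q + d + f by linarith,
    show M 2 2 = r + g + k by linarith]
  have hb0 : 0 ≤ b := by linarith
  have hc0 : 0 ≤ c := by linarith
  have hd0 : 0 ≤ d := by linarith
  have hf0 : 0 ≤ f := by linarith
  have hg0 : 0 ≤ g := by linarith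
  have hk0 : 0 ≤ k := by linarith
  rw [← hp] at h0
  rw [← hq] at h1
  rw [← hr] at h2
  ring_nf
  positivity

lemma det_hexJac_pos {x : R3} (hx : x ∈ refCube) : 0 < (hexJac x).det := by
  rw [mem_refCube] at hx
  refine det_pos_of_rowSum_pos (fun i j hij => ?_) fun i => ?_
  · fin_cases i <;> fin_cases j <;> first
      | exact absurd rfl hij
      | exact hexCoord_offDiag_nonpos (hx _).1 (hx _).2
  · fin_cases i
    · exact hexCoord_rowSum_pos (hx 0).2 (hx 1).2 (hx 2).2
    · refine (hexCoord_rowSum_pos (hx 1).2 (hx 0).2 (hx 2).2).trans_eq ?_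
      simp [hexJac]
      ring
    · refine (hexCoord_rowSum_pos (hx 2).2 (hx 0).2 (hx 1).2).trans_eq ?_
      simp [hexJac]
      ring

/-- This is the derivative of `hexCoord` in the direction (p, q, r). The last two coefficients are
nonpositive, so raising q and r to p only lowers it, down to p times a positive row sum. -/
lemma hexCoord_deriv_pos {a b c p q r : ℝ} (ha : -1 ≤ a) (ha1 : a ≤ 1) (hb1 : b ≤ 1)
    (hc1 : c ≤ 1) (hp : 0 < p) (hq : q ≤ p) (hr : r ≤ p) :
    0 < (6 - (1 + b) - (1 + c) + (1 + b) * (1 + c) / 4) / 24 * p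
      + (1 + a) / 2 * ((-1 + (1 + c) / 4) / 12) * q
      + (1 + a) / 2 * ((-1 + (1 + b) / 4) / 12) * r := by
  linarith [mul_pos (hexCoord_rowSum_pos ha1 hb1 hc1) hp,
    mul_le_mul_of_nonpos_left hq (hexCoord_offDiag_nonpos ha hc1),
    mul_le_mul_of_nonpos_left hr (hexCoord_offDiag_nonpos ha hb1)]

/-- The increment of one coordinate of the trilinear map is positive if the increment of its first
argument is positive and dominates the others. -/
lemma hexCoord_lt {a b c a' b' c' : ℝ} (ha : -1 ≤ a) (ha1 : a ≤ 1) (hb1 : b ≤ 1)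
    (hc1 : c ≤ 1) (ha' : -1 ≤ a') (ha1' : a' ≤ 1) (hb1' : b' ≤ 1) (hc1' : c' ≤ 1) (h : a < a')
    (hab : b' - b ≤ a' - a) (hac : c' - c ≤ a' - a) : hexCoord a b c < hexCoord a' b' c' := by
  have hp : 0 < a' - a := by linarith
  have h0 := hexCoord_deriv_pos ha ha1 hb1 hc1 hp hab hac
  have h1 := hexCoord_deriv_pos ha' ha1' hb1' hc1' hp hab hac
  -- Along the segment `hexCoord` is a cubic in the parameter, so Simpson's rule is exact for its
  -- derivative: the increment is (h0 + 4 h2 + h1)/6.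
  have h2 := hexCoord_deriv_pos (a := (a + a') / 2) (b := (b + b') / 2) (c := (c + c') / 2)
    (by linarith) (by linarith) (by linarith) (by linarith) hp hab hac
  unfold hexCoord
  linarith

lemma eq_of_hexMap_eq_of_le {x y : R3} (hx : x ∈ refCube) (hy : y ∈ refCube)
    (h : hexMap x = hexMap y) (i j k : Fin 3) (hx_i : hexMap x i = hexCoord (x i) (x j) (x k))
    (hy_i : hexMap y i = hexCoord (y i) (y j) (y k)) (hj : |y j - x j| ≤ |y i - x i|)
    (hk : |y k - x k| ≤ |y i - x i|) : y i = x i := by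
  rw [mem_refCube] at hx hy
  have e : hexCoord (x i) (x j) (x k) = hexCoord (y i) (y j) (y k) := by rw [← hx_i, ← hy_i, h]
  rcases lt_trichotomy (x i) (y i) with hl | hl | hl
  · rw [abs_of_pos (sub_pos.2 hl)] at hj hk
    exact absurd e (hexCoord_lt (hx i).1 (hx i).2 (hx j).2 (hx k).2 (hy i).1 (hy i).2
      (hy j).2 (hy k).2 hl (le_of_abs_le hj) (le_of_abs_le hk)).ne
  · exact hl.symm
  · rw [abs_sub_comm, abs_sub_comm (y i), abs_of_pos (sub_pos.2 hl)] at hj hk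
    exact absurd e (hexCoord_lt (hy i).1 (hy i).2 (hy j).2 (hy k).2 (hx i).1 (hx i).2
      (hx j).2 (hx k).2 hl (le_of_abs_le hj) (le_of_abs_le hk)).ne'

/-- Take the coordinate in which x and y differ most. The corresponding coordinate of `hexMap` would
change strictly, so this largest difference is zero. -/
lemma injOn_hexMap : InjOn hexMap refCube := by
  intro x hx y hy h
  have key (i j k : Fin 3) (hall : ∀ l, l = i ∨ l = j ∨ l = k) (hj : |y j - x j| ≤ |y i - x i|)
      (hk : |y k - x k| ≤ |y i - x i|) (e : y i = x i) : x = y := by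
    rw [e, sub_self, abs_zero] at hj hk
    have ej := sub_eq_zero.1 (abs_nonpos_iff.1 hj)
    have ek := sub_eq_zero.1 (abs_nonpos_iff.1 hk)
    funext l
    rcases hall l with rfl | rfl | rfl
    exacts [e.symm, ej.symm, ek.symm]
  rcases le_total |y 0 - x 0| |y 1 - x 1| with h01 | h01 <;>
    rcases le_total |y 0 - x 0| |y 2 - x 2| with h02 | h02 <;>
    rcases le_total |y 1 - x 1| |y 2 - x 2| with h12 | h12
  all_goals first
    | exact key 0 1 2 (by decide) ‹_› ‹_›
        (eq_of_hexMap_eq_of_le hx hy h 0 1 2 rfl rfl ‹_› ‹_›)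
    | exact key 1 0 2 (by decide) ‹_› ‹_›
        (eq_of_hexMap_eq_of_le hx hy h 1 0 2 rfl rfl ‹_› ‹_›)
    | exact key 2 0 1 (by decide) ‹_› ‹_›
        (eq_of_hexMap_eq_of_le hx hy h 2 0 1 rfl rfl ‹_› ‹_›)
    | exact key 0 1 2 (by decide) ‹_› (by linarith)
        (eq_of_hexMap_eq_of_le hx hy h 0 1 2 rfl rfl ‹_› (by linarith))
    | exact key 2 0 1 (by decide) (by linarith) (by linarith)
        (eq_of_hexMap_eq_of_le hx hy h 2 0 1 rfl rfl (by linarith) (by linarith))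

lemma contDiff_hexMap : ContDiff ℝ ⊤ hexMap := by
  rw [contDiff_pi]
  intro i
  fin_cases i <;> simp [hexMap, hexCoord] <;> fun_prop

/-! ### The hexahedron in barycentric coordinates -/

/-- The reference tetrahedron. -/
def refTet : Set R3 := {z | (∀ i, 0 ≤ z i) ∧ ∑ i, z i ≤ 1}

/-- The hexahedron at the origin of the reference tetrahedron. -/
def refHex : Set R3 := {z | ∀ i, 0 ≤ z i ∧ z i ≤ 1 - ∑ j, z j}

/-- The open hexahedron at the origin of the reference tetrahedron. -/
def refHexInt : Set R3 := {z | ∀ i, 0 < z i ∧ z i < 1 - ∑ j, z j}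

/-- The open reference cube. -/
def refCubeInt : Set R3 := Set.pi univ fun _ => Ioo (-1) 1

lemma mem_refCubeInt {x : R3} : x ∈ refCubeInt ↔ ∀ i, -1 < x i ∧ x i < 1 := by
  simp [refCubeInt]

lemma refCubeInt_subset : refCubeInt ⊆ refCube := fun _ hx =>
  mem_refCube.2 fun i => ⟨(mem_refCubeInt.1 hx i).1.le, (mem_refCubeInt.1 hx i).2.le⟩

lemma isOpen_refCubeInt : IsOpen refCubeInt := isOpen_set_pi finite_univ fun _ _ => isOpen_Ioo

lemma refCube_ae_eq : refCube =ᵐ[volume] refCubeInt :=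
  (Measure.univ_pi_Ioo_ae_eq_Icc (f := fun _ : Fin 3 => (-1 : ℝ)) (g := fun _ => 1)).symm

lemma hexCoord_factor_pos {b c : ℝ} (hb1 : b ≤ 1) (hc1 : c ≤ 1) :
    0 < (6 - (1 + b) - (1 + c) + (1 + b) * (1 + c) / 4) / 24 := by
  nlinarith [mul_nonneg (by linarith : 0 ≤ 3 - b) (by linarith : 0 ≤ 3 - c)]

lemma hexGap_factor_pos {b c : ℝ} (hb1 : b ≤ 1) (hc1 : c ≤ 1) :
    0 < (1 - (1 + b) / 4 - (1 + c) / 4 + (1 + b) * (1 + c) / 12) / 2 := by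
  nlinarith [mul_nonneg (by linarith : 0 ≤ 2 - b) (by linarith : 0 ≤ 2 - c)]

/-- The factorisation shows that, within the cube, exactly the face x_i = -1 goes to the plane z_i =
0. -/
lemma exists_hexMap_eq {x : R3} (hx : x ∈ refCube) (i : Fin 3) :
    ∃ g, 0 < g ∧ hexMap x i = (1 + x i) * g := by
  rw [mem_refCube] at hx
  fin_cases i
  · exact ⟨_, hexCoord_factor_pos (hx 1).2 (hx 2).2, by simp [hexMap, hexCoord]; ring⟩
  · exact ⟨_, hexCoord_factor_pos (hx 0).2 (hx 2).2, by simp [hexMap, hexCoord]; ring⟩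
  · exact ⟨_, hexCoord_factor_pos (hx 0).2 (hx 1).2, by simp [hexMap, hexCoord]; ring⟩

/-- Companion for the opposite face: exactly x_i = 1 goes to the plane where the barycentric
coordinates of the node and of vertex i agree. Hence all six faces of the image are planar. -/
lemma exists_hexMap_gap_eq {x : R3} (hx : x ∈ refCube) (i : Fin 3) :
    ∃ g, 0 < g ∧ 1 - ∑ j, hexMap x j - hexMap x i = (1 - x i) * g := by
  rw [mem_refCube] at hx
  simp only [Fin.sum_univ_three]
  fin_cases i
  · exact ⟨_, hexGap_factor_pos (hx 1).2 (hx 2).2, by simp [hexMap, hexCoord]; ring⟩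
  · exact ⟨_, hexGap_factor_pos (hx 0).2 (hx 2).2, by simp [hexMap, hexCoord]; ring⟩
  · exact ⟨_, hexGap_factor_pos (hx 0).2 (hx 1).2, by simp [hexMap, hexCoord]; ring⟩

lemma hexMap_pos_iff {x : R3} (hx : x ∈ refCube) {i : Fin 3} : 0 < hexMap x i ↔ -1 < x i := by
  obtain ⟨g, hg, h⟩ := exists_hexMap_eq hx i
  rw [h, mul_pos_iff_of_pos_right hg]
  constructor <;> intro <;> linarith

lemma hexMap_nonneg {x : R3} (hx : x ∈ refCube) (i : Fin 3) : 0 ≤ hexMap x i := by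
  obtain ⟨g, hg, h⟩ := exists_hexMap_eq hx i
  rw [h]
  exact mul_nonneg (by linarith [(mem_refCube.1 hx i).1]) hg.le

lemma hexMap_lt_iff {x : R3} (hx : x ∈ refCube) {i : Fin 3} :
    hexMap x i < 1 - ∑ j, hexMap x j ↔ x i < 1 := by
  obtain ⟨g, hg, h⟩ := exists_hexMap_gap_eq hx i
  rw [← sub_pos, h, mul_pos_iff_of_pos_right hg, sub_pos]

lemma hexMap_le {x : R3} (hx : x ∈ refCube) (i : Fin 3) :
    hexMap x i ≤ 1 - ∑ j, hexMap x j := by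
  obtain ⟨g, hg, h⟩ := exists_hexMap_gap_eq hx i
  rw [← sub_nonneg, h]
  exact mul_nonneg (by linarith [(mem_refCube.1 hx i).2]) hg.le

lemma hexMap_mem_refHex {x : R3} (hx : x ∈ refCube) : hexMap x ∈ refHex := fun i =>
  ⟨hexMap_nonneg hx i, hexMap_le hx i⟩

lemma hexMap_mem_refHexInt {x : R3} (hx : x ∈ refCube) :
    hexMap x ∈ refHexInt ↔ x ∈ refCubeInt := by
  simp only [refHexInt, mem_ofPred_eq, hexMap_pos_iff hx, hexMap_lt_iff hx, mem_refCubeInt]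

lemma isUnit_det_hexJac {x : R3} (hx : x ∈ refCube) : IsUnit (hexJac x).det :=
  (det_hexJac_pos hx).ne'.isUnit

/-- By the inverse function theorem, since the Jacobian is invertible on the cube. -/
lemma isOpen_hexMap_image : IsOpen (hexMap '' refCubeInt) := by
  rw [isOpen_iff_mem_nhds]
  rintro _ ⟨x, hx, rfl⟩
  have hs : HasStrictFDerivAt hexMap _ x :=
    contDiff_hexMap.contDiffAt.hasStrictFDerivAt' (hasFDerivAt_hexMap x) (by simp)
  rw [← hs.map_nhds_eq_of_surj ?_]
  · exact Filter.image_mem_map (isOpen_refCubeInt.mem_nhds hx)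
  · rw [LinearMap.range_eq_top]
    intro y
    refine ⟨(hexJac x)⁻¹ *ᵥ y, ?_⟩
    simp [Matrix.mulVec_mulVec,
      Matrix.mul_nonsing_inv _ (isUnit_det_hexJac (refCubeInt_subset hx))]

lemma convex_refHexInt : Convex ℝ refHexInt := by
  intro x hx y hy a b ha hb hab i
  have := hx i
  have := hy i
  simp only [Pi.add_apply, Pi.smul_apply, smul_eq_mul, Finset.sum_add_distrib, ← Finset.mul_sum]
  rcases ha.eq_or_lt with rfl | ha
  · obtain rfl : b = 1 := by linarith
    simpa using hy i
  · constructor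
    · nlinarith
    · nlinarith

lemma convex_refHex : Convex ℝ refHex := by
  intro x hx y hy a b ha hb hab i
  have := hx i
  have := hy i
  simp only [Pi.add_apply, Pi.smul_apply, smul_eq_mul, Finset.sum_add_distrib, ← Finset.mul_sum]
  constructor <;> nlinarith

lemma convex_refTet : Convex ℝ refTet := by
  intro x hx y hy a b ha hb hab
  refine ⟨fun i => ?_, ?_⟩
  · have := hx.1 i
    have := hy.1 i
    simp only [Pi.add_apply, Pi.smul_apply, smul_eq_mul]
    positivity
  · have := hx.2
    have := hy.2
    simp only [Pi.add_apply, Pi.smul_apply, smul_eq_mul, Finset.sum_add_distrib, ← Finset.mul_sum]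
    nlinarith

lemma isCompact_refCube : IsCompact refCube := isCompact_Icc

/-- A connectedness argument. A point of `refHexInt` hit by the closed cube is hit by the open one,
so the image of the open cube and the complement of the image of the closed cube are disjoint open
sets covering `refHexInt`. The image of 0 lies in the first. -/
lemma refHexInt_subset : refHexInt ⊆ hexMap '' refCubeInt := by
  refine convex_refHexInt.isPreconnected.subset_left_of_subset_union isOpen_hexMap_image
    (isCompact_refCube.image contDiff_hexMap.continuous).isClosed.isOpen_compl
    (disjoint_compl_right.mono_left (image_mono refCubeInt_subset)) ?_ ?_
  · intro z hz
    by_cases h : z ∈ hexMap '' refCube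
    · obtain ⟨x, hx, rfl⟩ := h
      exact .inl ⟨x, (hexMap_mem_refHexInt hx).1 hz, rfl⟩
    · exact .inr h
  · have h0 : (0 : R3) ∈ refCubeInt := mem_refCubeInt.2 fun i => by norm_num
    exact ⟨_, (hexMap_mem_refHexInt (refCubeInt_subset h0)).2 h0, mem_image_of_mem _ h0⟩

lemma refHex_subset_closure : refHex ⊆ closure refHexInt := by
  intro z hz
  -- Approach z along the segment from the interior point (1/5, 1/5, 1/5), where 1/5 < 1 - 3/5.
  have hc : Filter.Tendsto (fun t : ℝ => z + t • ((fun _ => 1 / 5 : R3) - z))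
      (nhdsWithin 0 (Ioo 0 1)) (nhds z) := by
    refine Filter.Tendsto.mono_left ?_ nhdsWithin_le_nhds
    have : Continuous fun t : ℝ => z + t • ((fun _ => 1 / 5 : R3) - z) := by fun_prop
    simpa using this.tendsto 0
  have : (nhdsWithin (0 : ℝ) (Ioo 0 1)).NeBot :=
    mem_closure_iff_nhdsWithin_neBot.1 (by rw [closure_Ioo zero_ne_one]; simp)
  refine mem_closure_of_tendsto hc ?_
  filter_upwards [self_mem_nhdsWithin] with t ht i
  have h := hz i
  simp only [Fin.sum_univ_three, Pi.add_apply, Pi.smul_apply, smul_eq_mul, Pi.sub_apply] at h ⊢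
  constructor <;> nlinarith [ht.1, ht.2]

lemma hexMap_image_refCube : hexMap '' refCube = refHex := by
  refine Subset.antisymm (image_subset_iff.2 fun x hx => hexMap_mem_refHex hx) ?_
  refine refHex_subset_closure.trans (closure_minimal ?_
    (isCompact_refCube.image contDiff_hexMap.continuous).isClosed)
  exact refHexInt_subset.trans (image_mono refCubeInt_subset)

/-! ### The affine chart of a tetrahedron -/

variable {S : Geometry.SimplicialComplex ℝ R3} (ν : AxisLabelling S) (K : Subcell S)

lemma axis_mem (i : Fin 3) : (ν K i : R3) ∈ K.cell := (ν K i).2.1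

lemma axis_ne (i : Fin 3) : (ν K i : R3) ≠ K.node := (ν K i).2.2

lemma axis_inj {i j : Fin 3} : (ν K i : R3) = ν K j ↔ i = j := by
  rw [Subtype.coe_inj, (ν K).injective.eq_iff]

lemma exists_axis {v : R3} (hv : v ∈ K.cell) (hne : v ≠ K.node) : ∃ i, (ν K i : R3) = v := by
  obtain ⟨i, hi⟩ := (ν K).surjective ⟨v, hv, hne⟩
  exact ⟨i, by rw [hi]⟩

lemma linearIndependent_edge : LinearIndependent ℝ fun i => (ν K i : R3) - K.node := by
  have h := (affineIndependent_iff_linearIndependent_vsub ℝ _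
    (⟨K.node, K.node_mem⟩ : K.cell)).1 (S.indep K.cell_mem)
  exact h.comp (fun i => ⟨⟨ν K i, axis_mem ν K i⟩, fun e => axis_ne ν K i (Subtype.ext_iff.1 e)⟩)
    fun i j hij => (axis_inj ν K).1 (by simpa using hij)

/-- The linear part of the affine chart of the tetrahedron. -/
def chartLin : R3 ≃ₗ[ℝ] R3 :=
  LinearEquiv.ofInjectiveEndo (Fintype.linearCombination ℝ fun i => (ν K i : R3) - K.node)
    (linearIndependent_edge ν K).fintypeLinearCombination_injective

/-- The affine chart of the tetrahedron that sends the origin to the node and the standard basis to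
the other three vertices. -/
def chart : R3 ≃ᵃ[ℝ] R3 := (chartLin ν K).toAffineEquiv.trans (AffineEquiv.constVAdd ℝ R3 K.node)

lemma chartLin_apply (z : R3) : chartLin ν K z = ∑ i, z i • ((ν K i : R3) - K.node) := by
  simp [chartLin, Fintype.linearCombination_apply]

lemma chart_eq (z : R3) : chart ν K z = K.node + chartLin ν K z := rfl

lemma chart_apply (z : R3) : chart ν K z = K.node + ∑ i, z i • ((ν K i : R3) - K.node) := by
  rw [chart_eq, chartLin_apply]

lemma continuous_chart : Continuous (chart ν K) :=
  (chart ν K).toAffineMap.continuous_of_finiteDimensional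

lemma continuous_chart_symm : Continuous (chart ν K).symm :=
  (chart ν K).symm.toAffineMap.continuous_of_finiteDimensional

lemma isOpen_chart_image {U : Set R3} (hU : IsOpen U) : IsOpen (chart ν K '' U) := by
  rw [show chart ν K '' U = (chart ν K).symm ⁻¹' U from
    (chart ν K).toEquiv.image_eq_preimage_symm U]
  exact hU.preimage (continuous_chart_symm ν K)

lemma chart_zero : chart ν K 0 = K.node := by simp [chart_apply]

lemma chart_single (i : Fin 3) : chart ν K (Pi.single i 1) = ν K i := by
  simp [chart_apply, Pi.single_apply]

lemma chart_symm_node : (chart ν K).symm K.node = 0 := by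
  rw [← chart_zero ν K, AffineEquiv.symm_apply_apply]

lemma chart_symm_axis (i : Fin 3) : (chart ν K).symm (ν K i) = Pi.single i 1 := by
  rw [← chart_single ν K, AffineEquiv.symm_apply_apply]

lemma hexVertex_eq (σ : Finset (Fin 3)) :
    hexVertex ν K σ = chart ν K fun i => if i ∈ σ then ((σ.card : ℝ) + 1)⁻¹ else 0 := by
  classical
  have hN : K.node ∉ σ.image fun i => (ν K i : R3) := by
    simp [axis_ne]
  have hinj : Set.InjOn (fun i => (ν K i : R3)) σ := fun i _ j _ h => (axis_inj ν K).1 h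
  have hc : ((σ.card : ℝ) + 1) ≠ 0 := by positivity
  rw [hexVertex, bary, chart_apply]
  rw [show (insert K.node (σ.image fun i => (ν K i : R3))).card = σ.card + 1 by
    rw [Finset.card_insert_of_notMem (by convert hN), Finset.card_image_of_injOn hinj]]
  rw [Finset.sum_insert hN, Finset.sum_image hinj]
  simp only [ite_smul, zero_smul, Finset.sum_ite_mem, Finset.univ_inter, ← Finset.smul_sum,
    Finset.sum_sub_distrib, Finset.sum_const, Nat.cast_add, Nat.cast_one]
  ext c
  simp
  field_simp
  ring

/-- In chart coordinates the eight vertices are the same for every tetrahedron, so expanding the sum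
over the eight subsets gives the same polynomial map each time. -/
lemma trilinear_eq (x : R3) : trilinear ν K x = chart ν K (hexMap x) := by
  have hu : (Finset.univ : Finset (Finset (Fin 3))) =
      {∅, {0}, {1}, {2}, {0, 1}, {0, 2}, {1, 2}, {0, 1, 2}} := by decide
  have hcompl : (∅ᶜ : Finset (Fin 3)) = {0, 1, 2} ∧ ({0}ᶜ : Finset (Fin 3)) = {1, 2} ∧
      ({1}ᶜ : Finset (Fin 3)) = {0, 2} ∧ ({2}ᶜ : Finset (Fin 3)) = {0, 1} ∧
      ({0, 1}ᶜ : Finset (Fin 3)) = {2} ∧ ({0, 2}ᶜ : Finset (Fin 3)) = {1} ∧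
      ({1, 2}ᶜ : Finset (Fin 3)) = {0} ∧ ({0, 1, 2}ᶜ : Finset (Fin 3)) = ∅ := by decide
  obtain ⟨h1, h2, h3, h4, h5, h6, h7, h8⟩ := hcompl
  rw [trilinear, hu]
  simp only [hexVertex_eq, chart_apply]
  repeat rw [Finset.sum_insert (by decide)]
  rw [Finset.sum_singleton, h1, h2, h3, h4, h5, h6, h7, h8]
  ext c
  simp [Fin.sum_univ_three, hexMap, hexCoord]
  ring

lemma weights_trilinear_nonneg {x : R3} (hx : x ∈ refCube) (σ : Finset (Fin 3)) :
    0 ≤ (∏ i ∈ σ, (1 + x i) / 2) * ∏ i ∈ σᶜ, (1 - x i) / 2 := by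
  rw [mem_refCube] at hx
  exact mul_nonneg (Finset.prod_nonneg fun i _ => by linarith [(hx i).1])
    (Finset.prod_nonneg fun i _ => by linarith [(hx i).2])

lemma weights_trilinear_sum (x : R3) :
    ∑ σ : Finset (Fin 3), ((∏ i ∈ σ, (1 + x i) / 2) * ∏ i ∈ σᶜ, (1 - x i) / 2) = 1 := by
  have := Finset.prod_add (fun i => (1 + x i) / 2) (fun i => (1 - x i) / 2) Finset.univ
  rw [Finset.powerset_univ] at this
  simp only [← Finset.compl_eq_univ_sdiff] at this
  rw [← this]
  exact Finset.prod_eq_one fun i _ => by ring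

lemma trilinear_mem_hex {x : R3} (hx : x ∈ refCube) : trilinear ν K x ∈ K.hex := by
  classical
  refine (convex_convexHull ℝ _).sum_mem (fun σ _ => weights_trilinear_nonneg hx σ)
    (weights_trilinear_sum x) fun σ _ => subset_convexHull ℝ _ ⟨_, ?_, ?_, rfl⟩
  · refine Finset.insert_subset K.node_mem fun v hv => ?_
    obtain ⟨i, _, rfl⟩ := Finset.mem_image.1 hv
    exact axis_mem ν K i
  · exact Finset.mem_insert_self _ _

lemma bary_eq_hexVertex {s : Finset R3} (hs : s ⊆ K.cell) (hN : K.node ∈ s) :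
    ∃ σ, bary s = hexVertex ν K σ := by
  classical
  refine ⟨Finset.univ.filter fun i => (ν K i : R3) ∈ s, ?_⟩
  rw [hexVertex]
  congr 1
  ext v
  simp only [Finset.mem_insert, Finset.mem_image, Finset.mem_filter, Finset.mem_univ, true_and]
  constructor
  · intro hv
    by_cases h : v = K.node
    · exact .inl h
    · obtain ⟨i, rfl⟩ := exists_axis ν K (hs hv) h
      exact .inr ⟨i, hv, rfl⟩
  · rintro (rfl | ⟨i, hi, rfl⟩) <;> assumption

lemma hex_subset : K.hex ⊆ chart ν K '' refHex := by
  refine convexHull_min ?_ (convex_refHex.affine_image (chart ν K).toAffineMap)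
  rintro _ ⟨s, hs, hN, rfl⟩
  obtain ⟨σ, h⟩ := bary_eq_hexVertex ν K hs hN
  rw [h, hexVertex_eq]
  refine mem_image_of_mem _ fun i => ⟨?_, ?_⟩
  · split_ifs <;> positivity
  · rw [Finset.sum_ite_mem, Finset.univ_inter, Finset.sum_const, nsmul_eq_mul]
    have hc : ((σ.card : ℝ) + 1) ≠ 0 := by positivity
    rw [show 1 - (σ.card : ℝ) * ((σ.card : ℝ) + 1)⁻¹ = ((σ.card : ℝ) + 1)⁻¹ by
      field_simp; ring]
    split_ifs
    · exact le_rfl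
    · positivity

/-- A circle of inclusions: the image lies in the hull, the weights being a partition of unity; the
hull lies in the chart image of `refHex`, whose inequalities the vertices satisfy; and that set is
the image again. -/
lemma trilinear_image : trilinear ν K '' refCube = K.hex := by
  refine Subset.antisymm (image_subset_iff.2 fun x hx => trilinear_mem_hex ν K hx) ?_
  refine (hex_subset ν K).trans ?_
  rw [← hexMap_image_refCube, image_image]
  exact (image_congr fun x _ => (trilinear_eq ν K x).symm).subset

lemma hex_eq : K.hex = chart ν K '' refHex := by
  rw [← trilinear_image ν K, ← hexMap_image_refCube, image_image]
  exact image_congr fun x _ => trilinear_eq ν K x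

lemma injOn_trilinear : InjOn (trilinear ν K) refCube := fun x hx y hy h =>
  injOn_hexMap hx hy ((chart ν K).injective (by rwa [trilinear_eq, trilinear_eq] at h))

lemma convexHull_cell_eq : convexHull ℝ (K.cell : Set R3) = chart ν K '' refTet := by
  refine Subset.antisymm (convexHull_min ?_ (convex_refTet.affine_image (chart ν K).toAffineMap)) ?_
  · intro v hv
    by_cases h : v = K.node
    · exact ⟨0, ⟨fun i => le_rfl, by simp⟩, h ▸ chart_zero ν K⟩
    · obtain ⟨i, rfl⟩ := exists_axis ν K hv h
      refine ⟨Pi.single i 1, ⟨fun j => ?_, by simp⟩, chart_single ν K i⟩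
      rw [Pi.single_apply]
      split_ifs <;> norm_num
  · rintro _ ⟨z, hz, rfl⟩
    have hv (v : R3) (h : v ∈ K.cell) : v ∈ convexHull ℝ (K.cell : Set R3) :=
      subset_convexHull ℝ _ h
    have := (convex_convexHull ℝ (K.cell : Set R3)).sum_mem (t := Finset.univ)
      (w := fun o : Option (Fin 3) => o.elim (1 - ∑ i, z i) z)
      (z := fun o => o.elim K.node fun i => ν K i) ?_ ?_ ?_
    · convert this using 1
      rw [chart_apply, Fintype.sum_option]
      ext c
      simp [Fin.sum_univ_three]
      ring
    · rintro (_ | i) _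
      · exact sub_nonneg.2 hz.2
      · exact hz.1 i
    · rw [Fintype.sum_option]
      simp
    · rintro (_ | i) _
      · exact hv _ K.node_mem
      · exact hv _ (axis_mem ν K i)

/-- The coordinate z_i vanishes at every vertex of the tetrahedron but `ν K i`, hence on the hull of
any set of vertices that misses it. -/
lemma axis_mem_of_pos {s : Finset R3} (hs : s ⊆ K.cell) {z : R3}
    (hz : chart ν K z ∈ convexHull ℝ (s : Set R3)) {i : Fin 3} (hi : z i ≠ 0) :
    (ν K i : R3) ∈ s := by
  by_contra hcon
  refine hi ?_
  have hsub : convexHull ℝ (s : Set R3) ⊆ (chart ν K).symm.toAffineMap ⁻¹' {z | z i = 0} := by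
    refine convexHull_min (fun v hv => ?_) (Convex.affine_preimage _ ?_)
    · by_cases h : v = K.node
      · simp [h, chart_symm_node]
      · obtain ⟨j, rfl⟩ := exists_axis ν K (hs hv) h
        have hij : i ≠ j := by
          rintro rfl
          exact hcon hv
        simp [chart_symm_axis, hij]
    · intro x hx y hy a b _ _ _
      simp_all
  simpa using hsub hz

/-- The coordinates sum to 1 at every vertex but the node, hence on the hull of any set of vertices
that misses the node. -/
lemma node_mem_of_lt {s : Finset R3} (hs : s ⊆ K.cell) {z : R3}
    (hz : chart ν K z ∈ convexHull ℝ (s : Set R3)) (hi : ∑ i, z i ≠ 1) : K.node ∈ s := by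
  by_contra hcon
  refine hi ?_
  have hsub : convexHull ℝ (s : Set R3) ⊆
      (chart ν K).symm.toAffineMap ⁻¹' {z | ∑ i, z i = 1} := by
    refine convexHull_min (fun v hv => ?_) (Convex.affine_preimage _ ?_)
    · have h : v ≠ K.node := by
        rintro rfl
        exact hcon hv
      obtain ⟨j, rfl⟩ := exists_axis ν K (hs hv) h
      simp [chart_symm_axis]
    · intro x hx y hy a b _ _ hab
      simp only [mem_ofPred_eq] at hx hy
      simp only [mem_ofPred_eq, Pi.add_apply, Pi.smul_apply, smul_eq_mul, Finset.sum_add_distrib,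
        ← Finset.mul_sum, hx, hy, mul_one, hab]
  simpa using hsub hz

/-! ### The boundary of a hexahedron -/

lemma Subcell.eq_of_cell_node {K K' : Subcell S} (h : K.cell = K'.cell) (h' : K.node = K'.node) :
    K = K' := by
  cases K
  cases K'
  simp_all

lemma refHex_subset_refTet : refHex ⊆ refTet := fun z hz =>
  ⟨fun i => (hz i).1, by linarith [(hz 0).1, (hz 0).2]⟩

include ν in
lemma hex_subset_convexHull : K.hex ⊆ convexHull ℝ (K.cell : Set R3) := by
  rw [hex_eq ν, convexHull_cell_eq ν]
  exact image_mono refHex_subset_refTet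

lemma chart_mem_interior {z : R3} (hz : ∀ i, 0 < z i) (hs : ∑ i, z i < 1) :
    chart ν K z ∈ interior (convexHull ℝ (K.cell : Set R3)) := by
  rw [convexHull_cell_eq ν]
  refine mem_interior.2 ⟨chart ν K '' {z | (∀ i, 0 < z i) ∧ ∑ i, z i < 1}, image_mono ?_,
    isOpen_chart_image ν K ?_, mem_image_of_mem _ ⟨hz, hs⟩⟩
  · exact fun z hz => ⟨fun i => (hz.1 i).le, hz.2.le⟩
  · simp only [ofPred_and, ofPred_forall]
    exact (isOpen_iInter_of_finite fun i => isOpen_lt continuous_const (continuous_apply i)).inter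
      (isOpen_lt (by fun_prop) continuous_const)

lemma hex_subset_dualCell : K.hex ⊆ dualCell S K.node :=
  subset_biUnion_of_mem (u := fun K : Subcell S => K.hex) (x := K) rfl

/-- If an interior point of the image of the chart is moved slightly, it stays inside. -/
lemma exists_chart_add_smul_mem {A : Set R3} {z : R3} (hz : chart ν K z ∈ interior A) (v : R3)
    {p : ℝ → Prop} (hp : ∀ᶠ t in nhdsWithin 0 (Ioi 0), p t) :
    ∃ t > 0, p t ∧ chart ν K (z + t • v) ∈ A := by
  have hc : Filter.Tendsto (fun t : ℝ => chart ν K (z + t • v)) (nhdsWithin 0 (Ioi 0))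
      (nhds (chart ν K z)) := by
    refine Filter.Tendsto.mono_left ?_ nhdsWithin_le_nhds
    have : Continuous fun t : ℝ => chart ν K (z + t • v) :=
      (continuous_chart ν K).comp (by fun_prop)
    simpa using this.tendsto 0
  obtain ⟨t, ⟨h1, h2⟩, h3⟩ := ((hc.eventually (mem_interior_iff_mem_nhds.1 hz)).and hp |>.and
    self_mem_nhdsWithin).exists
  exact ⟨t, h3, h2, h1⟩

include ν in
-- Two simplices of a complex meet in the hull of their common vertices. All barycentric coordinates
-- of the point are positive, so every vertex of the first tetrahedron is common.
lemma eq_of_mem_interior_of_mem {K' : Subcell S} {z : R3} (hz : ∀ i, 0 < z i)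
    (hs : ∑ i, z i < 1) (h : chart ν K z ∈ convexHull ℝ (K'.cell : Set R3)) :
    K.cell = K'.cell := by
  classical
  have h1 := S.inter_subset_convexHull K.cell_mem K'.cell_mem
    ⟨interior_subset (chart_mem_interior ν K hz hs), h⟩
  rw [← Finset.coe_inter] at h1
  have hsub : K.cell ⊆ K'.cell := by
    intro v hv
    refine Finset.mem_of_mem_inter_right (s₁ := K.cell) ?_
    by_cases hvN : v = K.node
    · rw [hvN]
      exact node_mem_of_lt ν K Finset.inter_subset_left h1 hs.ne
    · obtain ⟨i, rfl⟩ := exists_axis ν K hv hvN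
      exact axis_mem_of_pos ν K Finset.inter_subset_left h1 (hz i).ne'
  exact Finset.eq_of_subset_of_card_le hsub (by rw [K.cell_card, K'.cell_card])

lemma chart_front_notMem_primalBdry {z : R3} (hz : ∀ i, 0 < z i) (hs : ∑ i, z i < 1) :
    chart ν K z ∉ primalBdry K := fun h => h.2.2 (chart_mem_interior ν K hz hs)

lemma chart_front_mem_dualBdry {Ω : Set R3} (hΩ : IsOpen Ω) (hreg : interior (closure Ω) = Ω)
    (hcover : S.space = closure Ω) {z : R3} (hz : ∀ i, 0 < z i)
    (hle : ∀ i, z i ≤ 1 - ∑ j, z j) {i : Fin 3} (hi : z i = 1 - ∑ j, z j) :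
    chart ν K z ∈ dualBdry K Ω := by
  have hs : ∑ j, z j < 1 := by linarith [hz i]
  have hmem : chart ν K z ∈ K.hex := by
    rw [hex_eq ν]
    exact mem_image_of_mem _ fun j => ⟨(hz j).le, hle j⟩
  have hint : chart ν K z ∉ interior (dualCell S K.node) := by
    intro hcon
    -- A short step towards vertex i stays inside the tetrahedron but makes z_i exceed the
    -- coordinate of the node, which excludes K, the only hexahedron at the node available there.
    have hev : ∀ᶠ t : ℝ in nhdsWithin 0 (Ioi 0), t < 1 - ∑ j, z j :=
      nhdsWithin_le_nhds (gt_mem_nhds (by linarith))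
    obtain ⟨t, ht, hlt, h⟩ := exists_chart_add_smul_mem ν K hcon (Pi.single i 1) hev
    have hsum : ∑ j, (z + t • Pi.single i (1 : ℝ) : R3) j = ∑ j, z j + t := by
      simp [Finset.sum_add_distrib, ← Finset.mul_sum]
    obtain ⟨K', hK', h⟩ := mem_iUnion₂.1 h
    have hpos : ∀ j, 0 < (z + t • Pi.single i (1 : ℝ) : R3) j := fun j => by
      have : (0 : ℝ) ≤ (Pi.single i 1 : R3) j := by
        rw [Pi.single_apply]
        split_ifs <;> norm_num
      have := hz j
      simp only [Pi.add_apply, Pi.smul_apply, smul_eq_mul]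
      positivity
    have hcell := eq_of_mem_interior_of_mem ν K hpos (by rw [hsum]; linarith)
      (hex_subset_convexHull ν K' h)
    obtain rfl := Subcell.eq_of_cell_node hcell hK'.symm
    rw [hex_eq ν] at h
    obtain ⟨w, hw, e⟩ := h
    obtain rfl := (chart ν K).injective e
    have := (hw i).2
    rw [hsum] at this
    simp at this
    linarith
  refine ⟨⟨⟨subset_closure hmem, fun h => hint (interior_mono (hex_subset_dualCell K) h)⟩,
    subset_closure (hex_subset_dualCell K hmem), hint⟩, fun h => h.2 ?_⟩
  rw [hΩ.interior_eq, ← hreg, ← hcover]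
  exact interior_mono (S.convexHull_subset_space K.cell_mem) (chart_mem_interior ν K hz hs)

/-- Any step in the direction of decreasing z_i leaves the tetrahedron. -/
lemma chart_back_mem_primalBdry {z : R3} (hz : z ∈ refHex) {i : Fin 3} (hi : z i = 0) :
    chart ν K z ∈ primalBdry K := by
  have hmem : chart ν K z ∈ K.hex := by
    rw [hex_eq ν]
    exact mem_image_of_mem _ hz
  have hint : chart ν K z ∉ interior (convexHull ℝ (K.cell : Set R3)) := by
    intro hcon
    obtain ⟨t, ht, -, h⟩ := exists_chart_add_smul_mem ν K hcon (-Pi.single i 1)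
      (p := fun _ => True) (by simp)
    rw [convexHull_cell_eq ν] at h
    obtain ⟨w, hw, e⟩ := h
    obtain rfl := (chart ν K).injective e
    have := hw.1 i
    simp [hi] at this
    linarith
  exact ⟨⟨subset_closure hmem, fun h => hint (interior_mono (hex_subset_convexHull ν K) h)⟩,
    subset_closure (hex_subset_convexHull ν K hmem), hint⟩

/-- Near a point all simplices contain the point. -/
lemma eventually_mem_of_mem [Finite S.faces] (x : R3) :
    ∀ᶠ y in nhds x, ∀ s ∈ S.faces,
      y ∈ convexHull ℝ (s : Set R3) → x ∈ convexHull ℝ (s : Set R3) := by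
  rw [Filter.eventually_all_finite (Set.toFinite S.faces)]
  intro s _
  by_cases h : x ∈ convexHull ℝ (s : Set R3)
  · exact .of_forall fun _ _ => h
  · have hcl : IsClosed (convexHull ℝ (s : Set R3)) :=
      (s.finite_toSet.isCompact_convexHull ℝ).isClosed
    filter_upwards [hcl.isOpen_compl.mem_nhds h] with y hy hy'
    exact absurd hy' hy

lemma card_le_four {s : Finset R3} (hs : s ∈ S.faces) : s.card ≤ 4 := by
  have := (S.indep hs).card_le_finrank_succ
  have h2 := Submodule.finrank_le (vectorSpan ℝ (Set.range ((↑) : s → R3)))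
  rw [Fintype.card_coe] at this
  rw [Module.finrank_fin_fun] at h2
  exact this.trans (Nat.succ_le_succ h2)

lemma mem_hex_of_mem_convexHull {K' : Subcell S} {y : R3}
    (hy : y ∈ convexHull ℝ (K'.cell : Set R3))
    (h : ∀ i, (chart ν K').symm y i < 1 - ∑ j, (chart ν K').symm y j) : y ∈ K'.hex := by
  rw [convexHull_cell_eq ν] at hy
  obtain ⟨w, hw, rfl⟩ := hy
  rw [hex_eq ν]
  rw [AffineEquiv.symm_apply_apply] at h
  exact mem_image_of_mem _ fun i => ⟨hw.1 i, (h i).le⟩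

lemma eventually_gap {K' : Subcell S} {x : R3}
    (h : ∀ i, (chart ν K').symm x i < 1 - ∑ j, (chart ν K').symm x j) :
    ∀ᶠ y in nhds x, ∀ i, (chart ν K').symm y i < 1 - ∑ j, (chart ν K').symm y j := by
  have hc := continuous_chart_symm ν K'
  refine Filter.eventually_all.2 fun i => ?_
  exact (Continuous.continuousAt (by fun_prop)).eventually_lt
    (Continuous.continuousAt (by fun_prop)) (h i)

/-- A point inside a face of a tetrahedron that is closer to the node than to the other vertices
has this property in all tetrahedra that contain the face. -/
lemma chart_symm_gap {K' : Subcell S} (hnode : K'.node = K.node) {z : R3}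
    (hz : ∀ i, z i < 1 - ∑ j, z j) (hpos : 0 < 1 - ∑ j, z j)
    (hmem : ∀ i, z i ≠ 0 → (ν K i : R3) ∈ K'.cell) (l : Fin 3) :
    (chart ν K').symm (chart ν K z) l < 1 - ∑ j, (chart ν K').symm (chart ν K z) j := by
  classical
  -- The coordinates of the same point in the chart of K': each weight is moved to the axis of K'
  -- with the same vertex. Vertices not shared carry weight 0.
  set w : R3 := fun l => ∑ i, if (ν K i : R3) = ν K' l then z i else 0 with hw
  have hidx : ∀ i, z i ≠ 0 → ∃ l, (ν K' l : R3) = ν K i := fun i hi =>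
    exists_axis ν K' (hmem i hi) (by rw [hnode]; exact axis_ne ν K i)
  have e : chart ν K' w = chart ν K z := by
    rw [chart_apply, chart_apply, hw]
    simp only [hnode, Finset.sum_smul]
    congr 1
    rw [Finset.sum_comm]
    refine Finset.sum_congr rfl fun i _ => ?_
    by_cases hi : z i = 0
    · simp [hi]
    · obtain ⟨l, hl⟩ := hidx i hi
      simp only [← hl, axis_inj, ite_smul, zero_smul]
      simp
  have hsum : ∑ l, w l = ∑ i, z i := by
    rw [hw, Finset.sum_comm]
    refine Finset.sum_congr rfl fun i _ => ?_
    by_cases hi : z i = 0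
    · simp [hi]
    · obtain ⟨l, hl⟩ := hidx i hi
      simp [← hl, axis_inj]
  rw [← e, AffineEquiv.symm_apply_apply, hsum]
  by_cases h : ∃ i, (ν K i : R3) = ν K' l
  · obtain ⟨i, hi⟩ := h
    have : w l = z i := by
      simp [hw, ← hi, axis_inj]
    rw [this]
    exact hz i
  · have : w l = 0 := Finset.sum_eq_zero fun i _ => if_neg fun hi => h ⟨i, hi⟩
    rw [this]
    exact hpos

/-- Off ∂Ω, the point x inside the back face is interior to the mesh. A nearby point lies in a
simplex through x, which contains the triangle opposite to vertex i, node included. In every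
tetrahedron on that triangle the node's coordinate strictly dominates near x, so the nearby point
lies in a hexahedron at the node. -/
lemma chart_back_notMem_dualBdry [Finite S.faces] {Ω : Set R3} (hreg : interior (closure Ω) = Ω)
    (hcover : S.space = closure Ω) {z : R3} {i : Fin 3} (hi : z i = 0)
    (hpos : ∀ j, j ≠ i → 0 < z j) (hlt : ∀ j, z j < 1 - ∑ l, z l) :
    chart ν K z ∉ dualBdry K Ω := by
  classical
  rintro ⟨⟨hxK, hx⟩, hΩ⟩
  have hgap : 0 < 1 - ∑ l, z l := by simpa [hi] using hlt i
  have hxhex : chart ν K z ∈ K.hex := by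
    rw [hex_eq ν]
    refine mem_image_of_mem _ fun j => ⟨?_, (hlt j).le⟩
    by_cases h : j = i
    · rw [h, hi]
    · exact (hpos j h).le
  have hxcell := hex_subset_convexHull ν K hxhex
  have hxΩ : chart ν K z ∈ interior S.space := by
    have h1 : chart ν K z ∈ closure Ω :=
      hcover ▸ S.convexHull_subset_space K.cell_mem hxcell
    by_contra h2
    rw [hcover, hreg] at h2
    exact hΩ ⟨h1, fun h => h2 (interior_subset h)⟩
  refine hx.2 (mem_interior_iff_mem_nhds.2 ?_)
  have hev : ∀ᶠ y in nhds (chart ν K z), ∀ K' : Subcell S, K'.node = K.node →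
      (∀ j, z j ≠ 0 → (ν K j : R3) ∈ K'.cell) →
      ∀ l, (chart ν K').symm y l < 1 - ∑ j, (chart ν K').symm y j := by
    rw [Filter.eventually_all]
    intro K'
    by_cases h : K'.node = K.node ∧ ∀ j, z j ≠ 0 → (ν K j : R3) ∈ K'.cell
    · filter_upwards [eventually_gap ν (chart_symm_gap ν K h.1 hlt hgap h.2)] with y hy _ _
      exact hy
    · exact .of_forall fun y h1 h2 => absurd ⟨h1, h2⟩ h
  filter_upwards [hev, eventually_mem_of_mem (S := S) (chart ν K z),
    mem_interior_iff_mem_nhds.1 hxΩ] with y hy hmem hyS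
  obtain ⟨s, hs, hys⟩ := S.mem_space_iff.1 hyS
  have hxs := S.inter_subset_convexHull K.cell_mem hs ⟨hxcell, hmem s hs hys⟩
  rw [← Finset.coe_inter] at hxs
  have hN : K.node ∈ s := Finset.mem_of_mem_inter_right
    (node_mem_of_lt ν K Finset.inter_subset_left hxs (by linarith))
  have hax : ∀ j, z j ≠ 0 → (ν K j : R3) ∈ s := fun j hj => Finset.mem_of_mem_inter_right
    (axis_mem_of_pos ν K Finset.inter_subset_left hxs hj)
  obtain ⟨K', hK', hax', hyK'⟩ : ∃ K' : Subcell S, K'.node = K.node ∧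
      (∀ j, z j ≠ 0 → (ν K j : R3) ∈ K'.cell) ∧ y ∈ convexHull ℝ (K'.cell : Set R3) := by
    -- A simplex through the point with fewer than four vertices must be the triangle itself, and
    -- then K can serve as K'.
    by_cases hc : s.card = 4
    · exact ⟨⟨s, hs, hc, K.node, hN⟩, rfl, hax, hys⟩
    · refine ⟨K, rfl, fun j _ => axis_mem ν K j, convexHull_mono ?_ hys⟩
      have h3 : s.card ≤ 3 := by
        have := card_le_four hs
        omega
      have hf : insert K.node (((Finset.univ : Finset (Fin 3)).erase i).image
          fun j => (ν K j : R3)) = s := by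
        refine Finset.eq_of_subset_of_card_le (Finset.insert_subset hN ?_) ?_
        · intro v hv
          obtain ⟨j, hj, rfl⟩ := Finset.mem_image.1 hv
          exact hax j (hpos j (Finset.ne_of_mem_erase hj)).ne'
        · rw [Finset.card_insert_of_notMem (by simp [axis_ne]),
            Finset.card_image_of_injective _ fun a b h => (axis_inj ν K).1 h]
          simpa using h3
      rw [← hf]
      intro v hv
      rcases Finset.mem_insert.1 (Finset.mem_coe.1 hv) with rfl | hv
      · exact K.node_mem
      · obtain ⟨j, _, rfl⟩ := Finset.mem_image.1 hv
        exact axis_mem ν K j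
  rw [← hK']
  exact hex_subset_dualCell K' (mem_hex_of_mem_convexHull ν hyK' (hy K' hK' hax'))

/-! ### Surface integrals over the two parts of the boundary -/

lemma facePoint_self (i : Fin 3) (s : ℝ) (y : Fin 2 → ℝ) : facePoint i s y i = s := by
  simp [facePoint]

lemma facePoint_mem_refCube {i : Fin 3} {s : ℝ} (hs : s ∈ Icc (-1 : ℝ) 1) {y : Fin 2 → ℝ}
    (hy : y ∈ Icc (-1) 1) : facePoint i s y ∈ refCube := by
  refine mem_refCube.2 fun j => ?_
  rcases Fin.eq_self_or_eq_succAbove i j with rfl | ⟨k, rfl⟩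
  · rwa [facePoint_self]
  · simp only [facePoint, Fin.insertNth_apply_succAbove]
    exact ⟨hy.1 k, hy.2 k⟩

lemma facePoint_mem_Ioo {i : Fin 3} {s : ℝ} {y : Fin 2 → ℝ}
    (hy : y ∈ Set.pi univ fun _ : Fin 2 => Ioo (-1 : ℝ) 1) {j : Fin 3} (hj : j ≠ i) :
    -1 < facePoint i s y j ∧ facePoint i s y j < 1 := by
  obtain ⟨k, rfl⟩ := (Fin.eq_self_or_eq_succAbove i j).resolve_left hj
  simp only [facePoint, Fin.insertNth_apply_succAbove]
  exact hy k (mem_univ k)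

lemma trilinear_front_mem_dualBdry {Ω : Set R3} (hΩ : IsOpen Ω) (hreg : interior (closure Ω) = Ω)
    (hcover : S.space = closure Ω) (i : Fin 3) {y : Fin 2 → ℝ}
    (hy : y ∈ Set.pi univ fun _ : Fin 2 => Ioo (-1 : ℝ) 1) :
    trilinear ν K (facePoint i 1 y) ∈ dualBdry K Ω ∧
      trilinear ν K (facePoint i 1 y) ∉ primalBdry K := by
  have hx : facePoint i 1 y ∈ refCube := facePoint_mem_refCube (by norm_num)
    ⟨fun k => (hy k trivial).1.le, fun k => (hy k trivial).2.le⟩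
  have hz : ∀ j, 0 < hexMap (facePoint i 1 y) j := fun j => by
    rw [hexMap_pos_iff hx]
    by_cases h : j = i
    · rw [h, facePoint_self]
      norm_num
    · exact (facePoint_mem_Ioo hy h).1
  have hi : hexMap (facePoint i 1 y) i = 1 - ∑ j, hexMap (facePoint i 1 y) j := by
    refine (hexMap_le hx i).antisymm (not_lt.1 ?_)
    rw [hexMap_lt_iff hx, facePoint_self]
    exact lt_irrefl _
  rw [trilinear_eq]
  exact ⟨chart_front_mem_dualBdry ν K hΩ hreg hcover hz (hexMap_le hx) hi,
    chart_front_notMem_primalBdry ν K hz (by linarith [hz i])⟩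

lemma trilinear_back_mem_primalBdry [Finite S.faces] {Ω : Set R3}
    (hreg : interior (closure Ω) = Ω)
    (hcover : S.space = closure Ω) (i : Fin 3) {y : Fin 2 → ℝ}
    (hy : y ∈ Set.pi univ fun _ : Fin 2 => Ioo (-1 : ℝ) 1) :
    trilinear ν K (facePoint i (-1) y) ∈ primalBdry K ∧
      trilinear ν K (facePoint i (-1) y) ∉ dualBdry K Ω := by
  have hx : facePoint i (-1) y ∈ refCube := facePoint_mem_refCube (by norm_num)
    ⟨fun k => (hy k trivial).1.le, fun k => (hy k trivial).2.le⟩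
  have hi : hexMap (facePoint i (-1) y) i = 0 := by
    refine (not_lt.1 ?_).antisymm (hexMap_nonneg hx i)
    rw [hexMap_pos_iff hx, facePoint_self]
    exact lt_irrefl _
  rw [trilinear_eq]
  refine ⟨chart_back_mem_primalBdry ν K (hexMap_mem_refHex hx) hi,
    chart_back_notMem_dualBdry ν K hreg hcover hi (fun j hj => ?_) fun j => ?_⟩
  · rw [hexMap_pos_iff hx]
    exact (facePoint_mem_Ioo hy hj).1
  · rw [hexMap_lt_iff hx]
    by_cases h : j = i
    · rw [h, facePoint_self]
      norm_num
    · exact (facePoint_mem_Ioo hy h).2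

lemma face_ae_eq : (Icc (-1) 1 : Set (Fin 2 → ℝ)) =ᵐ[volume]
    Set.pi univ fun _ : Fin 2 => Ioo (-1 : ℝ) 1 :=
  (Measure.univ_pi_Ioo_ae_eq_Icc (f := fun _ : Fin 2 => (-1 : ℝ)) (g := fun _ => 1)).symm

lemma setIntegral_face_of_mem {A : Set R3} {i : Fin 3} {s : ℝ} (f : (Fin 2 → ℝ) → ℝ)
    (h : ∀ y ∈ Set.pi univ fun _ : Fin 2 => Ioo (-1 : ℝ) 1, trilinear ν K (facePoint i s y) ∈ A) :
    ∫ y in {y : Fin 2 → ℝ | y ∈ Icc (-1) 1 ∧ trilinear ν K (facePoint i s y) ∈ A}, f y =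
      ∫ y in Icc (-1) 1, f y := by
  refine setIntegral_congr_set ?_
  filter_upwards [face_ae_eq.mem_iff] with y hy
  exact propext ⟨fun hy => hy.1, fun hy' => ⟨hy', h y (hy.1 hy')⟩⟩

lemma setIntegral_face_of_notMem {A : Set R3} {i : Fin 3} {s : ℝ} (f : (Fin 2 → ℝ) → ℝ)
    (h : ∀ y ∈ Set.pi univ fun _ : Fin 2 => Ioo (-1 : ℝ) 1, trilinear ν K (facePoint i s y) ∉ A) :
    ∫ y in {y : Fin 2 → ℝ | y ∈ Icc (-1) 1 ∧ trilinear ν K (facePoint i s y) ∈ A}, f y = 0 := by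
  refine setIntegral_measure_zero _ (measure_mono_null (fun y hy => ?_)
    (ae_le_set.1 face_ae_eq.le))
  exact ⟨hy.1, fun hy' => h y hy' hy.2⟩

/-- Open front faces lie entirely in the dual part and open back faces miss it; the edges are null
sets. -/
lemma flux_dualBdry [Finite S.faces] {Ω : Set R3} (hΩ : IsOpen Ω)
    (hreg : interior (closure Ω) = Ω) (hcover : S.space = closure Ω) (v : R3 → R3) :
    flux ν K (dualBdry K Ω) v = ∑ i, ∫ y in Icc (-1) 1, fluxDensity ν K v i 1 y := by
  refine Finset.sum_congr rfl fun i _ => ?_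
  rw [Finset.sum_pair (by norm_num), setIntegral_face_of_notMem ν K _ fun y hy =>
    (trilinear_back_mem_primalBdry ν K hreg hcover i hy).2,
    setIntegral_face_of_mem ν K _ fun y hy =>
    (trilinear_front_mem_dualBdry ν K hΩ hreg hcover i hy).1, zero_add]

lemma flux_primalBdry [Finite S.faces] {Ω : Set R3} (hΩ : IsOpen Ω)
    (hreg : interior (closure Ω) = Ω) (hcover : S.space = closure Ω) (v : R3 → R3) :
    flux ν K (primalBdry K) v = ∑ i, ∫ y in Icc (-1) 1, fluxDensity ν K v i (-1) y := by
  refine Finset.sum_congr rfl fun i _ => ?_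
  rw [Finset.sum_pair (by norm_num), setIntegral_face_of_mem ν K _ fun y hy =>
    (trilinear_back_mem_primalBdry ν K hreg hcover i hy).1, setIntegral_face_of_notMem ν K _
    fun y hy => (trilinear_front_mem_dualBdry ν K hΩ hreg hcover i hy).2, add_zero]

/-! ### Vector calculus -/

/-- The dot product as a continuous bilinear map. -/
def dotCLM : R3 →L[ℝ] R3 →L[ℝ] ℝ := LinearMap.toContinuousBilinearMap (dotProductBilin ℝ ℝ)

/-- The cross product as a continuous bilinear map. -/
def crossCLM : R3 →L[ℝ] R3 →L[ℝ] R3 := LinearMap.toContinuousBilinearMap crossProduct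

lemma dotCLM_apply (v w : R3) : dotCLM v w = v ⬝ᵥ w := rfl

lemma crossCLM_apply (v w : R3) : crossCLM v w = v ⨯₃ w := rfl

lemma map_eq_sum_single (f : R3 →L[ℝ] R3) (p : R3) : f p = ∑ j, p j • f (Pi.single j 1) := by
  conv_lhs => rw [pi_eq_sum_univ' p]
  simp only [map_sum, map_smul]

/-- Describes the curl as the antisymmetric part of the derivative, a form that can be pulled back
without coordinates. -/
lemma curl_dotProduct_cross (v : R3 → R3) (x p q : R3) :
    curl v x ⬝ᵥ (p ⨯₃ q) = fderiv ℝ v x p ⬝ᵥ q - fderiv ℝ v x q ⬝ᵥ p := by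
  rw [map_eq_sum_single _ p, map_eq_sum_single _ q]
  simp [curl, cross_apply, dotProduct, Fin.sum_univ_three]
  ring

lemma mulVec_cross_mulVec (M : Matrix (Fin 3) (Fin 3) ℝ) (p q : R3) :
    (M *ᵥ p) ⨯₃ (M *ᵥ q) = M.adjugateᵀ *ᵥ (p ⨯₃ q) := by
  rw [Matrix.adjugate_fin_three]
  ext i
  fin_cases i <;>
    simp [cross_apply, Matrix.mulVec, dotProduct, Fin.sum_univ_three] <;> ring

/-- A vector is determined by its products with cross products. -/
lemma eq_of_dotProduct_cross {u w : R3} (h : ∀ p q : R3, u ⬝ᵥ (p ⨯₃ q) = w ⬝ᵥ (p ⨯₃ q)) :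
    u = w := by
  have h0 := h (Pi.single 1 1) (Pi.single 2 1)
  have h1 := h (Pi.single 2 1) (Pi.single 0 1)
  have h2 := h (Pi.single 0 1) (Pi.single 1 1)
  simp [cross_apply, dotProduct, Fin.sum_univ_three] at h0 h1 h2
  ext i
  fin_cases i <;> assumption

/-- The curl of a field `v` and the curl of its pullback by `F`. -/
lemma curl_pullback {F v vhat : R3 → R3} {x : R3} (hF : ContDiff ℝ ⊤ F)
    (hv : DifferentiableAt ℝ v (F x)) (hvhat : DifferentiableAt ℝ vhat x)
    (h : ∀ᶠ y in nhds x, ∀ a, vhat y ⬝ᵥ a = v (F y) ⬝ᵥ fderiv ℝ F y a) (p q : R3) :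
    curl vhat x ⬝ᵥ (p ⨯₃ q) = curl v (F x) ⬝ᵥ (fderiv ℝ F x p ⨯₃ fderiv ℝ F x q) := by
  have hF1 : HasFDerivAt F (fderiv ℝ F x) x := (hF.differentiable (by simp) x).hasFDerivAt
  have hF2 : HasFDerivAt (fderiv ℝ F) (fderiv ℝ (fderiv ℝ F) x) x :=
    ((hF.fderiv_right (m := ⊤) (by simp)).differentiable (by simp) x).hasFDerivAt
  have hsymm : IsSymmSndFDerivAt ℝ F x := hF.contDiffAt.isSymmSndFDerivAt (by simp)
  -- Differentiate the pullback relation along b. The term with the second derivative of F is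
  -- symmetric in a and b, and cancels on antisymmetrising.
  have key (a b : R3) : fderiv ℝ vhat x b ⬝ᵥ a =
      fderiv ℝ v (F x) (fderiv ℝ F x b) ⬝ᵥ fderiv ℝ F x a
        + v (F x) ⬝ᵥ fderiv ℝ (fderiv ℝ F) x b a := by
    have h1 := dotCLM.hasFDerivAt_of_bilinear hvhat.hasFDerivAt (hasFDerivAt_const a x)
    have h2 := dotCLM.hasFDerivAt_of_bilinear (hv.hasFDerivAt.comp x hF1)
      (hF2.clm_apply (hasFDerivAt_const a x))
    have h3 := h1.unique (h2.congr_of_eventuallyEq (h.mono fun y hy => hy a))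
    have := DFunLike.congr_fun h3 b
    simp [dotCLM_apply] at this
    linarith
  rw [curl_dotProduct_cross, curl_dotProduct_cross, key, key, hsymm.eq p q]
  ring

/-- `div (u × w) = curl u · w - u · curl w`. -/
lemma div_cross {u w : R3 → R3} {x : R3} (hu : DifferentiableAt ℝ u x)
    (hw : DifferentiableAt ℝ w x) :
    ∑ i, fderiv ℝ (fun x => u x ⨯₃ w x) x (Pi.single i 1) i =
      curl u x ⬝ᵥ w x - curl w x ⬝ᵥ u x := by
  have h := (crossCLM.hasFDerivAt_of_bilinear hu.hasFDerivAt hw.hasFDerivAt).fderiv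
  simp only [crossCLM_apply] at h
  rw [h]
  simp [crossCLM_apply, curl, cross_apply, dotProduct, Fin.sum_univ_three]
  ring

lemma contDiff_curl {u : R3 → R3} (hu : ContDiff ℝ ⊤ u) : ContDiff ℝ ⊤ (curl u) := by
  have h : ContDiff ℝ ⊤ (fderiv ℝ u) := hu.fderiv_right (by simp)
  have h' (i j : Fin 3) : ContDiff ℝ ⊤ fun x => fderiv ℝ u x (Pi.single j 1) i :=
    contDiff_pi.1 (h.clm_apply contDiff_const) i
  rw [contDiff_pi]
  intro i
  fin_cases i
  exacts [(h' 2 1).sub (h' 1 2), (h' 0 2).sub (h' 2 0), (h' 1 0).sub (h' 0 1)]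

lemma continuous_dotProduct {u w : R3 → R3} (hu : Continuous u) (hw : Continuous w) :
    Continuous fun x => u x ⬝ᵥ w x := (dotCLM.continuous.comp hu).clm_apply hw

lemma contDiff_cross {u w : R3 → R3} (hu : ContDiff ℝ ⊤ u) (hw : ContDiff ℝ ⊤ w) :
    ContDiff ℝ ⊤ fun x => u x ⨯₃ w x := (crossCLM.contDiff.comp hu).clm_apply hw

/-- The divergence theorem on the reference cube for a cross product. -/
lemma integral_curl_sub_curl {u w : R3 → R3} (hu : ContDiff ℝ ⊤ u) (hw : ContDiff ℝ ⊤ w) :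
    (∫ x in refCube, curl u x ⬝ᵥ w x) - ∫ x in refCube, curl w x ⬝ᵥ u x =
      ∑ i, ((∫ y in Icc (-1) 1, (u (facePoint i 1 y) ⨯₃ w (facePoint i 1 y)) i) -
        ∫ y in Icc (-1) 1, (u (facePoint i (-1) y) ⨯₃ w (facePoint i (-1) y)) i) := by
  have hI {u w : R3 → R3} (hu : ContDiff ℝ ⊤ u) (hw : ContDiff ℝ ⊤ w) :
      IntegrableOn (fun x => curl u x ⬝ᵥ w x) refCube :=
    (continuous_dotProduct (contDiff_curl hu).continuous
      hw.continuous).continuousOn.integrableOn_compact isCompact_refCube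
  have hc := contDiff_cross hu hw
  have hdiv (x : R3) := div_cross (hu.differentiable (by simp) x) (hw.differentiable (by simp) x)
  rw [← integral_sub (hI hu hw) (hI hw hu)]
  simp only [← hdiv]
  refine integral_divergence_of_hasFDerivAt_off_countable (-1 : Fin 3 → ℝ) 1
    (fun i => by norm_num [Pi.le_def])
    (fun x => u x ⨯₃ w x) _ ∅ countable_empty hc.continuous.continuousOn
    (fun x _ => (hc.differentiable (by simp) x).hasFDerivAt) ?_
  simp only [hdiv]
  exact (hI hu hw).sub (hI hw hu)

/-! ### The Piola transform -/

/-- The orientation of the chart of a tetrahedron. -/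
def orientation : ℝ :=
  |LinearMap.det (chartLin ν K : R3 →ₗ[ℝ] R3)| / LinearMap.det (chartLin ν K : R3 →ₗ[ℝ] R3)

lemma hasFDerivAt_trilinear (x : R3) : HasFDerivAt (trilinear ν K)
    (LinearMap.toContinuousLinearMap ((chartLin ν K : R3 →ₗ[ℝ] R3) ∘ₗ
      Matrix.toLin' (hexJac x))) x := by
  have h1 := ((LinearMap.toContinuousLinearMap (chartLin ν K : R3 →ₗ[ℝ] R3)).hasFDerivAt
    (x := hexMap x)).comp x (hasFDerivAt_hexMap x)
  have h2 := h1.const_add K.node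
  exact h2.congr_of_eventuallyEq (.of_forall fun x => trilinear_eq ν K x)

lemma contDiff_trilinear : ContDiff ℝ ⊤ (trilinear ν K) := by
  have : trilinear ν K = fun x => K.node +
      LinearMap.toContinuousLinearMap (chartLin ν K : R3 →ₗ[ℝ] R3) (hexMap x) :=
    funext fun x => trilinear_eq ν K x
  rw [this]
  exact contDiff_const.add ((ContinuousLinearMap.contDiff _).comp contDiff_hexMap)

lemma det_jac (x : R3) :
    (jac ν K x).det = LinearMap.det (chartLin ν K : R3 →ₗ[ℝ] R3) * (hexJac x).det := by
  rw [jac, LinearMap.det_toMatrix', (hasFDerivAt_trilinear ν K x).fderiv]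
  rw [LinearMap.coe_toContinuousLinearMap, LinearMap.det_comp, LinearMap.det_toLin']

lemma det_chartLin_ne_zero : LinearMap.det (chartLin ν K : R3 →ₗ[ℝ] R3) ≠ 0 :=
  (LinearEquiv.isUnit_det' (chartLin ν K)).ne_zero

lemma det_jac_ne_zero {x : R3} (hx : x ∈ refCube) : (jac ν K x).det ≠ 0 := by
  rw [det_jac]
  exact mul_ne_zero (det_chartLin_ne_zero ν K) (det_hexJac_pos hx).ne'

/-- The determinant of `hexJac` is positive, so the sign is that of the affine chart and does not
vary over the cube. It can therefore be pulled out of all integrals. -/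
lemma abs_det_jac {x : R3} (hx : x ∈ refCube) :
    |(jac ν K x).det| = orientation ν K * (jac ν K x).det := by
  have := det_chartLin_ne_zero ν K
  rw [det_jac, abs_mul, abs_of_pos (det_hexJac_pos hx), orientation]
  field_simp

lemma jac_mulVec (x a : R3) : jac ν K x *ᵥ a = fderiv ℝ (trilinear ν K) x a := by
  rw [jac, LinearMap.toMatrix'_mulVec]
  rfl

lemma invFunOn_trilinear {x : R3} (hx : x ∈ refCube) :
    Function.invFunOn (trilinear ν K) refCube (trilinear ν K x) = x :=
  (injOn_trilinear ν K).leftInvOn_invFunOn hx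

lemma piola_trilinear (vhat : R3 → R3) {x : R3} (hx : x ∈ refCube) :
    piola ν K vhat (trilinear ν K x) = ((jac ν K x)⁻¹)ᵀ *ᵥ vhat x := by
  rw [piola, invFunOn_trilinear ν K hx]

lemma piola_dotProduct_fderiv (vhat : R3 → R3) {x : R3} (hx : x ∈ refCube) (a : R3) :
    piola ν K vhat (trilinear ν K x) ⬝ᵥ fderiv ℝ (trilinear ν K) x a = vhat x ⬝ᵥ a := by
  rw [piola_trilinear ν K vhat hx, ← jac_mulVec, Matrix.mulVec_transpose,
    ← Matrix.dotProduct_mulVec, Matrix.mulVec_mulVec,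
    Matrix.nonsing_inv_mul _ (det_jac_ne_zero ν K hx).isUnit, Matrix.one_mulVec]

lemma differentiable_jac_apply (i j : Fin 3) : Differentiable ℝ fun x => jac ν K x i j := by
  have h : ContDiff ℝ ⊤ (fderiv ℝ (trilinear ν K)) :=
    (contDiff_trilinear ν K).fderiv_right (by simp)
  have h' : ContDiff ℝ ⊤ fun x => fderiv ℝ (trilinear ν K) x (Pi.single j 1) i :=
    contDiff_pi.1 (h.clm_apply contDiff_const) i
  have e : (fun x => jac ν K x i j) = fun x => fderiv ℝ (trilinear ν K) x (Pi.single j 1) i := by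
    funext x
    rw [← jac_mulVec]
    simp
  rw [e]
  exact h'.differentiable (by simp)

lemma differentiableAt_inv_jac_mulVec {vhat : R3 → R3} {x : R3} (hx : x ∈ refCube)
    (hv : DifferentiableAt ℝ vhat x) :
    DifferentiableAt ℝ (fun x => ((jac ν K x)⁻¹)ᵀ *ᵥ vhat x) x := by
  have hJ (i j : Fin 3) : DifferentiableAt ℝ (fun x => jac ν K x i j) x :=
    differentiable_jac_apply ν K i j x
  have hdet : DifferentiableAt ℝ (fun x => (jac ν K x).det) x := by
    simp only [Matrix.det_fin_three]
    fun_prop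
  have hvi (i : Fin 3) : DifferentiableAt ℝ (fun x => vhat x i) x :=
    differentiableAt_pi.1 hv i
  have hinv := hdet.inv (det_jac_ne_zero ν K hx)
  rw [differentiableAt_pi]
  intro i
  have hadj (j : Fin 3) : DifferentiableAt ℝ (fun x => (jac ν K x).adjugate j i) x := by
    simp only [Matrix.adjugate_fin_three]
    fin_cases i <;> fin_cases j <;> simp <;> fun_prop
  simp only [Matrix.mulVec, dotProduct, Matrix.transpose_apply, Matrix.inv_def,
    Matrix.smul_apply, Ring.inverse_eq_inv', smul_eq_mul]
  exact DifferentiableAt.fun_sum fun j _ => (hinv.mul (hadj j)).mul (hvi j)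

/-- Near the image of an interior point, the set-theoretic inverse in `piola` agrees with the local
inverse of the inverse function theorem, by injectivity on the cube. -/
lemma differentiableAt_piola {vhat : R3 → R3} {x : R3} (hx : x ∈ refCubeInt)
    (hv : DifferentiableAt ℝ vhat x) :
    DifferentiableAt ℝ (piola ν K vhat) (trilinear ν K x) := by
  have hx' := refCubeInt_subset hx
  have hdet : (fderiv ℝ (trilinear ν K) x).det ≠ 0 := by
    have := det_jac_ne_zero ν K hx'
    rwa [jac, LinearMap.det_toMatrix'] at this
  have hs : HasStrictFDerivAt (trilinear ν K)
      (((fderiv ℝ (trilinear ν K) x).toContinuousLinearEquivOfDetNeZero hdet : R3 ≃L[ℝ] R3) :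
        R3 →L[ℝ] R3) x := by
    refine (contDiff_trilinear ν K).contDiffAt.hasStrictFDerivAt' ?_ (by simp)
    exact ((contDiff_trilinear ν K).differentiable (by simp) x).hasFDerivAt
  have hg := hs.to_localInverse.hasFDerivAt.differentiableAt
  have hgx : hs.localInverse _ _ _ (trilinear ν K x) = x := hs.localInverse_apply_image
  have hmem : ∀ᶠ y in nhds (trilinear ν K x), hs.localInverse _ _ _ y ∈ refCubeInt :=
    hs.localInverse_tendsto.eventually (isOpen_refCubeInt.mem_nhds hx)
  refine (DifferentiableAt.comp (trilinear ν K x)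
    (g := fun x => ((jac ν K x)⁻¹)ᵀ *ᵥ vhat x) ?_ hg).congr_of_eventuallyEq ?_
  · rw [hgx]
    exact differentiableAt_inv_jac_mulVec ν K hx' hv
  · filter_upwards [hmem, hs.eventually_right_inverse] with y hy hy'
    conv_lhs => rw [← hy']
    exact piola_trilinear ν K vhat (refCubeInt_subset hy)

lemma inv_eq_smul_adjugate {x : R3} :
    (jac ν K x)⁻¹ = (jac ν K x).det⁻¹ • (jac ν K x).adjugate := by
  rw [Matrix.inv_def, Ring.inverse_eq_inv']

/-- The curl transforms contravariantly, by J / det J, and w covariantly, by the inverse transpose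
of J; in the product the matrices cancel and leave 1 / det J, which the volume element absorbs up to
sign. -/
lemma curl_piola_dotProduct {u : R3 → R3} (w : R3 → R3) {x : R3} (hx : x ∈ refCubeInt)
    (hu : DifferentiableAt ℝ u x) :
    curl (piola ν K u) (trilinear ν K x) ⬝ᵥ piola ν K w (trilinear ν K x) =
      (jac ν K x).det⁻¹ * (curl u x ⬝ᵥ w x) := by
  have hcurl : curl u x =
      (jac ν K x).adjugate *ᵥ curl (piola ν K u) (trilinear ν K x) := by
    refine eq_of_dotProduct_cross fun p q => ?_
    rw [curl_pullback (contDiff_trilinear ν K) (differentiableAt_piola ν K hx hu) hu ?_ p q,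
      ← jac_mulVec, ← jac_mulVec, mulVec_cross_mulVec, Matrix.dotProduct_mulVec,
      Matrix.vecMul_transpose]
    filter_upwards [isOpen_refCubeInt.mem_nhds hx] with y hy a
    exact (piola_dotProduct_fderiv ν K u (refCubeInt_subset hy) a).symm
  rw [piola_trilinear ν K w (refCubeInt_subset hx), hcurl, inv_eq_smul_adjugate,
    Matrix.dotProduct_mulVec, Matrix.vecMul_transpose, Matrix.smul_mulVec, smul_dotProduct,
    smul_eq_mul]

/-- The cross product is transformed by the cofactor matrix of the inverse transpose of J. Against
|det J| times that inverse transpose applied to the normal, only |det J| / det J remains. -/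
lemma fluxDensity_piola_cross (u w : R3 → R3) {i : Fin 3} {s : ℝ} {y : Fin 2 → ℝ}
    (hs : s ∈ Icc (-1 : ℝ) 1) (hy : y ∈ Icc (-1) 1) :
    fluxDensity ν K (fun x => piola ν K u x ⨯₃ piola ν K w x) i s y =
      orientation ν K * ((u (facePoint i s y) ⨯₃ w (facePoint i s y)) i * s) := by
  have hx := facePoint_mem_refCube (i := i) hs hy
  have hd := det_jac_ne_zero ν K hx
  have hM : ((jac ν K (facePoint i s y))⁻¹)ᵀ.adjugate * ((jac ν K (facePoint i s y))⁻¹)ᵀ =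
      (jac ν K (facePoint i s y)).det⁻¹ • (1 : Matrix (Fin 3) (Fin 3) ℝ) := by
    rw [Matrix.adjugate_mul, Matrix.det_transpose, Matrix.det_nonsing_inv, Ring.inverse_eq_inv']
  rw [fluxDensity]
  simp only [piola_trilinear ν K _ hx]
  rw [mulVec_cross_mulVec, abs_det_jac ν K hx, dotProduct_smul, Matrix.mulVec_transpose,
    ← Matrix.dotProduct_mulVec, Matrix.mulVec_mulVec, hM, Matrix.smul_mulVec, Matrix.one_mulVec,
    dotProduct_smul, dotProduct_single, smul_eq_mul, smul_eq_mul]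
  field_simp

/-- Only almost everywhere: the curl of the transformed field is computed at interior points, and
the faces of the cube are null. -/
lemma hex_integrand_ae_eq {u : R3 → R3} (w : R3 → R3) (hu : ContDiff ℝ ⊤ u) :
    (fun x => |(fderiv ℝ (trilinear ν K) x).det| •
        (curl (piola ν K u) (trilinear ν K x) ⬝ᵥ piola ν K w (trilinear ν K x)))
      =ᵐ[volume.restrict refCube] fun x => orientation ν K * (curl u x ⬝ᵥ w x) := by
  rw [Measure.restrict_congr_set refCube_ae_eq]
  refine (ae_restrict_iff' isOpen_refCubeInt.measurableSet).2 (.of_forall fun x hx => ?_)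
  have hx' := refCubeInt_subset hx
  have hd := det_jac_ne_zero ν K hx'
  have : (fderiv ℝ (trilinear ν K) x).det = (jac ν K x).det := by
    rw [jac, LinearMap.det_toMatrix']
  dsimp only
  rw [this, curl_piola_dotProduct ν K w hx (hu.differentiable (by simp) x), abs_det_jac ν K hx',
    smul_eq_mul]
  field_simp

lemma measurableSet_refCube : MeasurableSet refCube := isCompact_refCube.measurableSet

lemma hasFDerivWithinAt_trilinear (x : R3) :
    HasFDerivWithinAt (trilinear ν K) (fderiv ℝ (trilinear ν K) x) refCube x :=
  ((contDiff_trilinear ν K).differentiable (by simp) x).hasFDerivAt.hasFDerivWithinAt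

lemma integrableOn_curl_piola {u w : R3 → R3} (hu : ContDiff ℝ ⊤ u) (hw : ContDiff ℝ ⊤ w) :
    IntegrableOn (fun x => curl (piola ν K u) x ⬝ᵥ piola ν K w x) K.hex := by
  rw [← trilinear_image ν K, integrableOn_image_iff_integrableOn_abs_det_fderiv_smul volume
    measurableSet_refCube (fun x _ => hasFDerivWithinAt_trilinear ν K x) (injOn_trilinear ν K)]
  refine IntegrableOn.congr_fun_ae ?_ (hex_integrand_ae_eq ν K w hu).symm
  exact ((continuous_dotProduct (contDiff_curl hu).continuous
    hw.continuous).const_mul _).continuousOn.integrableOn_compact isCompact_refCube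

lemma integral_curl_piola {u : R3 → R3} (w : R3 → R3) (hu : ContDiff ℝ ⊤ u) :
    ∫ x in K.hex, curl (piola ν K u) x ⬝ᵥ piola ν K w x =
      orientation ν K * ∫ x in refCube, curl u x ⬝ᵥ w x := by
  rw [← trilinear_image ν K, integral_image_eq_integral_abs_det_fderiv_smul volume
    measurableSet_refCube (fun x _ => hasFDerivWithinAt_trilinear ν K x) (injOn_trilinear ν K),
    integral_congr_ae (hex_integrand_ae_eq ν K w hu), integral_const_mul]

lemma integrableOn_fluxDensity {u w : R3 → R3} (hu : ContDiff ℝ ⊤ u) (hw : ContDiff ℝ ⊤ w)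
    (i : Fin 3) {s : ℝ} (hs : s ∈ Icc (-1 : ℝ) 1) :
    IntegrableOn (fluxDensity ν K (fun x => piola ν K u x ⨯₃ piola ν K w x) i s)
      (Icc (-1) 1) := by
  refine IntegrableOn.congr_fun ?_
    (fun y hy => (fluxDensity_piola_cross ν K u w hs hy).symm) measurableSet_Icc
  have hc : Continuous fun y : Fin 2 → ℝ => facePoint i s y := by
    unfold facePoint
    fun_prop
  have : Continuous fun y => (u (facePoint i s y) ⨯₃ w (facePoint i s y)) i :=
    (continuous_apply i).comp ((contDiff_cross hu hw).continuous.comp hc)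
  exact (Continuous.continuousOn (by fun_prop)).integrableOn_compact isCompact_Icc

lemma integral_fluxDensity (u w : R3 → R3) (i : Fin 3) {s : ℝ} (hs : s ∈ Icc (-1 : ℝ) 1) :
    ∫ y in Icc (-1) 1, fluxDensity ν K (fun x => piola ν K u x ⨯₃ piola ν K w x) i s y =
      orientation ν K *
        ((∫ y in Icc (-1) 1, (u (facePoint i s y) ⨯₃ w (facePoint i s y)) i) * s) := by
  rw [setIntegral_congr_fun measurableSet_Icc fun y hy => fluxDensity_piola_cross ν K u w hs hy,
    integral_const_mul, integral_mul_const]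

/-- Integration by parts on one hexahedron. -/
lemma hex_term_eq [Finite S.faces] {Ω : Set R3} (hΩ : IsOpen Ω)
    (hreg : interior (closure Ω) = Ω) (hcover : S.space = closure Ω) {u w : R3 → R3}
    (hu : ContDiff ℝ ⊤ u) (hw : ContDiff ℝ ⊤ w) :
    -flux ν K (dualBdry K Ω) (fun x => piola ν K u x ⨯₃ piola ν K w x)
        + ∫ x in K.hex, curl (piola ν K u) x ⬝ᵥ piola ν K w x =
      -flux ν K (primalBdry K) (fun x => piola ν K w x ⨯₃ piola ν K u x)
        + ∫ x in K.hex, curl (piola ν K w) x ⬝ᵥ piola ν K u x := by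
  have hs1 : (1 : ℝ) ∈ Icc (-1 : ℝ) 1 := by norm_num
  have hs2 : (-1 : ℝ) ∈ Icc (-1 : ℝ) 1 := by norm_num
  rw [flux_dualBdry ν K hΩ hreg hcover, flux_primalBdry ν K hΩ hreg hcover,
    integral_curl_piola ν K w hu, integral_curl_piola ν K u hw]
  have h := integral_curl_sub_curl hu hw
  rw [Finset.sum_sub_distrib] at h
  simp only [integral_fluxDensity ν K _ _ _ hs1, integral_fluxDensity ν K _ _ _ hs2,
    ← Finset.mul_sum, mul_one, mul_neg, Finset.sum_neg_distrib]
  -- On the back faces the sign from swapping the factors offsets the sign of the outward normal.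
  simp only [← cross_anticomm (u _) (w _), Pi.neg_apply, integral_neg, Finset.sum_neg_distrib]
  linear_combination orientation ν K * h

/-! ### The basis functions -/

variable {P : ℕ} (ξ : Fin (P + 1) → ℝ)

lemma contDiff_ell (α : Fin 3 → Fin (P + 1)) : ContDiff ℝ ⊤ (ell ξ α) := by
  unfold ell
  refine contDiff_prod fun j _ => ?_
  have h : ContDiff ℝ ⊤ fun t : ℝ => (Lagrange.basis Finset.univ ξ (α j)).eval t := by
    simpa only [Polynomial.coe_aeval_eq_eval] using
      (Lagrange.basis Finset.univ ξ (α j)).contDiff_aeval (𝕜 := ℝ) ⊤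
  exact h.comp (contDiff_apply ℝ ℝ j)

lemma EIndex.contDiff_ref (n : EIndex S P) : ContDiff ℝ ⊤ (n.ref ν K ξ) := by
  unfold EIndex.ref
  by_cases h : K.node = n.node ∧ n.simplex ⊆ K.cell
  · simp only [if_pos h]
    refine contDiff_pi.2 fun i => ?_
    split_ifs
    · exact contDiff_ell ξ _
    · exact contDiff_const
  · simp only [if_neg h]
    exact contDiff_const

lemma HIndex.contDiff_ref (m : HIndex S P) : ContDiff ℝ ⊤ (m.ref ν K ξ) := by
  unfold HIndex.ref
  by_cases h : K.cell = m.cell ∧ K.node ∈ m.core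
  · simp only [if_pos h]
    refine contDiff_pi.2 fun i => ?_
    split_ifs
    · exact (contDiff_ell ξ _).comp contDiff_neg
    · exact contDiff_const
  · simp only [if_neg h]
    exact contDiff_const

lemma piola_zero : piola ν K 0 = 0 := by
  funext x
  simp [piola]

lemma EIndex.field_eq_zero {n : EIndex S P} (h : ¬(K.node = n.node ∧ n.simplex ⊆ K.cell)) :
    n.field ν K ξ = 0 := by
  have : n.ref ν K ξ = 0 := by
    funext x
    rw [EIndex.ref, if_neg h]
    rfl
  rw [EIndex.field, this, piola_zero]

lemma HIndex.field_eq_zero {m : HIndex S P} (h : ¬(K.cell = m.cell ∧ K.node ∈ m.core)) :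
    m.field ν K ξ = 0 := by
  have : m.ref ν K ξ = 0 := by
    funext x
    rw [HIndex.ref, if_neg h]
    rfl
  rw [HIndex.field, this, piola_zero]

lemma flux_zero (A : Set R3) : flux ν K A (fun _ => 0) = 0 := by
  simp [flux, fluxDensity]

lemma curl_zero (x : R3) : curl 0 x = 0 := by
  simp [curl]

lemma exists_of_curlH_ne_zero [Finite S.faces] {m : HIndex S P} {n : EIndex S P}
    (h : curlH ν ξ m n ≠ 0) : ∃ K : Subcell S, (K.node = n.node ∧ n.simplex ⊆ K.cell) ∧
      K.cell = m.cell ∧ K.node ∈ m.core := by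
  obtain ⟨K, -, hK⟩ := Finset.exists_ne_zero_of_sum_ne_zero h
  refine ⟨K, ?_, ?_⟩
  · by_contra hn
    refine hK ?_
    simp [EIndex.field_eq_zero ν K ξ hn, flux_zero]
  · by_contra hm
    refine hK ?_
    simp [HIndex.field_eq_zero ν K ξ hm, flux_zero, curl_zero]

/-! ### Counting -/

lemma encard_biUnion_le_mul {α β : Type*} {s : Set α} (hs : s.Finite) (f : α → Set β) {c : ℕ∞}
    (h : ∀ a ∈ s, (f a).encard ≤ c) : (⋃ a ∈ s, f a).encard ≤ s.encard * c := by
  induction s, hs using Set.Finite.induction_on with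
  | empty => simp
  | @insert a s ha _ ih =>
    rw [biUnion_insert, encard_insert_of_notMem ha, add_mul, one_mul, add_comm]
    exact (encard_union_le _ _).trans (add_le_add (h a (mem_insert _ _))
      (ih fun b hb => h b (mem_insert_of_mem _ hb)))

lemma encard_univ_code :
    (univ : Set (Fin 3 × (Fin 3 → Fin (P + 1)))).encard = 3 * ((P : ℕ∞) + 1) ^ 3 := by
  rw [encard_univ, ENat.card_eq_coe_fintype_card]
  simp

open Classical in
/-- The axis towards a vertex (`0` if the vertex is not a vertex of the tetrahedron, or is the
node). -/
def axisOf (v : R3) : Fin 3 :=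
  if h : v ∈ K.cell ∧ v ≠ K.node then (ν K).symm ⟨v, h⟩ else 0

lemma axis_axisOf {v : R3} (hv : v ∈ K.cell) (hne : v ≠ K.node) :
    (ν K (axisOf ν K v) : R3) = v := by
  rw [axisOf, dif_pos ⟨hv, hne⟩, Equiv.apply_symm_apply]

lemma eq_of_axisOf_eq {v w : R3} (hv : v ∈ K.cell) (hne : v ≠ K.node) (hw : w ∈ K.cell)
    (hne' : w ≠ K.node) (h : axisOf ν K v = axisOf ν K w) : v = w := by
  rw [← axis_axisOf ν K hv hne, ← axis_axisOf ν K hw hne', h]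

open Classical in
/-- The degrees of a function on the dual mesh, along the axes of a hexahedron. -/
def EIndex.axisDeg (n : EIndex S P) (j : Fin 3) : Fin (P + 1) :=
  if h : (ν K j : R3) ∈ n.simplex ∧ (ν K j : R3) ≠ n.node then n.deg ⟨ν K j, h⟩ else 0

open Classical in
/-- The degrees of a function on the primal mesh, along the axes of a hexahedron. -/
def HIndex.axisDeg (m : HIndex S P) (j : Fin 3) : Fin (P + 1) :=
  if h : (ν K j : R3) ∈ m.cell ∧ (ν K j : R3) ∉ m.core then m.deg ⟨ν K j, h⟩ else 0

/-- The simplex can be read off the degrees: off `dir` a zero degree is forbidden on the simplex, so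
the default 0 marks exactly the axes outside it. This makes the code injective. -/
lemma EIndex.mem_simplex_iff {n : EIndex S P} (hn : K.node = n.node ∧ n.simplex ⊆ K.cell)
    (v : R3) : v ∈ n.simplex ↔
      v = K.node ∨ v = n.dir ∨ ∃ j, (ν K j : R3) = v ∧ n.axisDeg ν K j ≠ 0 := by
  constructor
  · intro hv
    by_contra! hcon
    obtain ⟨h1, h2, h3⟩ := hcon
    obtain ⟨j, rfl⟩ := exists_axis ν K (hn.2 hv) h1
    have h := h3 j rfl
    rw [EIndex.axisDeg, dif_pos ⟨hv, hn.1 ▸ h1⟩] at h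
    exact n.deg_ne _ h2 h
  · rintro (rfl | rfl | ⟨j, rfl, hj⟩)
    · rw [hn.1]
      exact n.node_mem
    · exact n.dir_mem
    · by_contra h
      exact hj (dif_neg fun h' => h h'.1)

/-- Same decoding on the primal side, where the default 0 marks the vertices of `core`. -/
lemma HIndex.notMem_core_iff {m : HIndex S P} (hm : K.cell = m.cell ∧ K.node ∈ m.core)
    {v : R3} (hv : v ∈ K.cell) : v ∉ m.core ↔
      v = m.dir ∨ ∃ j, (ν K j : R3) = v ∧ m.axisDeg ν K j ≠ 0 := by
  constructor
  · intro hvc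
    by_contra! hcon
    obtain ⟨h2, h3⟩ := hcon
    have h1 : v ≠ K.node := by
      rintro rfl
      exact hvc hm.2
    obtain ⟨j, rfl⟩ := exists_axis ν K hv h1
    have h := h3 j rfl
    rw [HIndex.axisDeg, dif_pos ⟨hm.1 ▸ hv, hvc⟩] at h
    exact m.deg_ne _ h2 h
  · rintro (rfl | ⟨j, rfl, hj⟩)
    · exact m.dir_notMem
    · intro h
      exact hj (dif_neg fun h' => h'.2 h)

lemma EIndex.injOn_code : InjOn (fun n : EIndex S P => (axisOf ν K n.dir, n.axisDeg ν K))
    {n | K.node = n.node ∧ n.simplex ⊆ K.cell} := by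
  intro n hn n' hn' h
  obtain ⟨h1, h2⟩ := Prod.ext_iff.1 h
  dsimp only at h1 h2
  have hdir : n.dir = n'.dir := eq_of_axisOf_eq ν K (hn.2 n.dir_mem) (hn.1 ▸ n.dir_ne)
    (hn'.2 n'.dir_mem) (hn'.1 ▸ n'.dir_ne) h1
  have hnode : n.node = n'.node := hn.1.symm.trans hn'.1
  have hF : n.simplex = n'.simplex := by
    ext v
    rw [EIndex.mem_simplex_iff ν K hn, EIndex.mem_simplex_iff ν K hn', hdir, h2]
  obtain ⟨N, F, _, hN, w, _, _, a, _⟩ := n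
  obtain ⟨N', F', _, _, w', _, _, a', _⟩ := n'
  dsimp only at hdir hnode hF
  subst hdir hnode hF
  have ha : a = a' := by
    funext v
    obtain ⟨j, hj⟩ := exists_axis ν K (hn.2 v.2.1) (hn.1 ▸ v.2.2)
    have := congrFun h2 j
    obtain ⟨v, hv⟩ := v
    dsimp only at hj
    subst hj
    rwa [EIndex.axisDeg, EIndex.axisDeg, dif_pos hv, dif_pos hv] at this
  subst ha
  rfl

lemma HIndex.injOn_code : InjOn (fun m : HIndex S P => (axisOf ν K m.dir, m.axisDeg ν K))
    {m | K.cell = m.cell ∧ K.node ∈ m.core} := by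
  intro m hm m' hm' h
  obtain ⟨h1, h2⟩ := Prod.ext_iff.1 h
  dsimp only at h1 h2
  have hne {m : HIndex S P} (hm : K.node ∈ m.core) : m.dir ≠ K.node := fun e =>
    m.dir_notMem (e ▸ hm)
  have hdir : m.dir = m'.dir := eq_of_axisOf_eq ν K (hm.1 ▸ m.dir_mem) (hne hm.2)
    (hm'.1 ▸ m'.dir_mem) (hne hm'.2) h1
  have hcell : m.cell = m'.cell := hm.1.symm.trans hm'.1
  have hcore : m.core = m'.core := by
    ext v
    by_cases hv : v ∈ K.cell
    · rw [← not_iff_not, HIndex.notMem_core_iff ν K hm hv, HIndex.notMem_core_iff ν K hm' hv, hdir,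
        h2]
    · exact iff_of_false (fun h => hv (hm.1 ▸ m.core_subset h))
        (fun h => hv (hm'.1 ▸ m'.core_subset h))
  obtain ⟨T, _, _, M, _, _, w, _, _, a, _⟩ := m
  obtain ⟨T', _, _, M', _, _, w', _, _, a', _⟩ := m'
  dsimp only at hdir hcell hcore
  subst hdir hcell hcore
  have ha : a = a' := by
    funext v
    have hvN : v.1 ≠ K.node := fun e => v.2.2 (e ▸ hm.2)
    obtain ⟨j, hj⟩ := exists_axis ν K (hm.1 ▸ v.2.1) hvN
    have := congrFun h2 j
    obtain ⟨v, hv⟩ := v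
    dsimp only at hj
    subst hj
    rwa [HIndex.axisDeg, HIndex.axisDeg, dif_pos hv, dif_pos hv] at this
  subst ha
  rfl

include ν in
lemma EIndex.encard_le : {n : EIndex S P | K.node = n.node ∧ n.simplex ⊆ K.cell}.encard ≤
    3 * ((P : ℕ∞) + 1) ^ 3 := by
  rw [← (EIndex.injOn_code ν K).encard_image, ← encard_univ_code]
  exact encard_le_encard (subset_univ _)

include ν in
lemma HIndex.encard_le : {m : HIndex S P | K.cell = m.cell ∧ K.node ∈ m.core}.encard ≤
    3 * ((P : ℕ∞) + 1) ^ 3 := by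
  rw [← (HIndex.injOn_code ν K).encard_image, ← encard_univ_code]
  exact encard_le_encard (subset_univ _)

lemma encard_subcell_of_cell {T : Finset R3} (hT : T.card = 4) :
    {K : Subcell S | K.cell = T}.encard ≤ 4 := by
  have hinj : InjOn (fun K : Subcell S => K.node) {K | K.cell = T} := fun K hK K' hK' h =>
    Subcell.eq_of_cell_node (hK.trans hK'.symm) h
  rw [← hinj.encard_image]
  have : (fun K : Subcell S => K.node) '' {K | K.cell = T} ⊆ (T : Set R3) := by
    rintro _ ⟨K, rfl, rfl⟩
    exact K.node_mem
  refine (encard_le_encard this).trans ?_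
  rw [encard_coe_eq_coe_finsetCard, hT]
  rfl

/-- A tetrahedron has four hexahedra, each carrying at most 3(P + 1)³ functions of the dual basis.
-/
lemma encard_row_le [Finite S.faces] (m : HIndex S P) :
    {n | curlH ν ξ m n ≠ 0}.encard ≤ 12 * ((P : ℕ∞) + 1) ^ 3 := by
  have hsub : {n | curlH ν ξ m n ≠ 0} ⊆ ⋃ K ∈ {K : Subcell S | K.cell = m.cell},
      {n : EIndex S P | K.node = n.node ∧ n.simplex ⊆ K.cell} := by
    intro n hn
    obtain ⟨K, h1, h2⟩ := exists_of_curlH_ne_zero ν ξ hn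
    exact mem_biUnion (x := K) h2.1 h1
  refine (encard_le_encard hsub).trans ((encard_biUnion_le_mul (Set.toFinite _) _
    fun K _ => EIndex.encard_le ν K).trans ?_)
  refine (mul_le_mul_left (encard_subcell_of_cell m.cell_card) _).trans_eq ?_
  rw [← mul_assoc]
  norm_num

lemma encard_column_le [Finite S.faces] (n : EIndex S P) :
    {m | curlH ν ξ m n ≠ 0}.encard ≤
      3 * ((P : ℕ∞) + 1) ^ 3 * {K : Subcell S | K.node = n.node}.encard := by
  have hsub : {m | curlH ν ξ m n ≠ 0} ⊆ ⋃ K ∈ {K : Subcell S | K.node = n.node},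
      {m : HIndex S P | K.cell = m.cell ∧ K.node ∈ m.core} := by
    intro m hm
    obtain ⟨K, h1, h2⟩ := exists_of_curlH_ne_zero ν ξ hm
    exact mem_biUnion (x := K) h1.1 h2
  rw [mul_comm]
  exact (encard_le_encard hsub).trans (encard_biUnion_le_mul (Set.toFinite _) _
    fun K _ => HIndex.encard_le ν K)

lemma curlH_eq_zero_of_disjoint [Finite S.faces] {m : HIndex S P} {n : EIndex S P}
    (h : Disjoint (convexHull ℝ (m.cell : Set R3)) (dualCell S n.node)) :
    curlH ν ξ m n = 0 := by
  by_contra hne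
  obtain ⟨K, h1, h2⟩ := exists_of_curlH_ne_zero ν ξ hne
  -- The image of the cube's centre witnesses that a common hexahedron makes the two cells meet.
  have hx : trilinear ν K 0 ∈ K.hex := trilinear_mem_hex ν K (mem_refCube.2 fun i => by norm_num)
  refine Set.disjoint_left.1 h (?_ : trilinear ν K 0 ∈ _) ?_
  · rw [← h2.1]
    exact hex_subset_convexHull ν K hx
  · rw [← h1.1]
    exact hex_subset_dualCell K hx

end

end DualCell

theorem mainTheorem1
    (Ω : Set DualCell.R3) (hΩ : IsOpen Ω) (hreg : interior (closure Ω) = Ω)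
    (S : Geometry.SimplicialComplex ℝ DualCell.R3) [Finite S.faces] (hcover : S.space = closure Ω)
    (ν : DualCell.AxisLabelling S)
    (P : ℕ) (hP : 0 < P) (ξ : Fin (P + 1) → ℝ) (hξ : DualCell.IsGaussRadau P ξ) :
    -- all integrals that enter the two matrices converge
    (∀ (K : DualCell.Subcell S) (n : DualCell.EIndex S P) (m : DualCell.HIndex S P),
      IntegrableOn (fun x => DualCell.curl (n.field ν K ξ) x ⬝ᵥ m.field ν K ξ x) K.hex ∧
      IntegrableOn (fun x => DualCell.curl (m.field ν K ξ) x ⬝ᵥ n.field ν K ξ x) K.hex ∧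
      ∀ (i : Fin 3), ∀ s ∈ ({-1, 1} : Finset ℝ),
        IntegrableOn (DualCell.fluxDensity ν K
          (fun x => n.field ν K ξ x ⨯₃ m.field ν K ξ x) i s) (Icc (-1) 1)) ∧
    -- the two discrete curl matrices are transposes of each other
    DualCell.curlE ν ξ Ω = (DualCell.curlH ν ξ)ᵀ ∧
    -- each basis function is supported in a single dual or primal cell
    (∀ (n : DualCell.EIndex S P) (K : DualCell.Subcell S),
      (∃ x ∈ K.hex, n.field ν K ξ x ≠ 0) → K.hex ⊆ DualCell.dualCell S n.node) ∧
    (∀ (m : DualCell.HIndex S P) (K : DualCell.Subcell S),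
      (∃ x ∈ K.hex, m.field ν K ξ x ≠ 0) → K.hex ⊆ convexHull ℝ (m.cell : Set DualCell.R3)) ∧
    -- sparsity: entries vanish for disjoint cells, with the resulting row and column counts
    (∀ (m : DualCell.HIndex S P) (n : DualCell.EIndex S P),
      Disjoint (convexHull ℝ (m.cell : Set DualCell.R3)) (DualCell.dualCell S n.node) →
        DualCell.curlH ν ξ m n = 0) ∧
    (∀ m : DualCell.HIndex S P,
      {n | DualCell.curlH ν ξ m n ≠ 0}.encard ≤ 12 * ((P : ℕ∞) + 1) ^ 3) ∧
    (∀ n : DualCell.EIndex S P,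
      {m | DualCell.curlH ν ξ m n ≠ 0}.encard ≤
        3 * ((P : ℕ∞) + 1) ^ 3 * {K : DualCell.Subcell S | K.node = n.node}.encard) := by
  refine ⟨fun K n m => ⟨?_, ?_, fun i s hs => ?_⟩, ?_, fun n K => ?_, fun m K => ?_, ?_, ?_, ?_⟩
  · exact DualCell.integrableOn_curl_piola ν K (n.contDiff_ref ν K ξ) (m.contDiff_ref ν K ξ)
  · exact DualCell.integrableOn_curl_piola ν K (m.contDiff_ref ν K ξ) (n.contDiff_ref ν K ξ)
  · refine DualCell.integrableOn_fluxDensity ν K (n.contDiff_ref ν K ξ) (m.contDiff_ref ν K ξ) i ?_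
    rcases Finset.mem_insert.1 hs with rfl | hs
    · norm_num
    · rw [Finset.mem_singleton.1 hs]
      norm_num
  · ext n m
    exact Finset.sum_congr rfl fun K _ => DualCell.hex_term_eq ν K hΩ hreg hcover
      (n.contDiff_ref ν K ξ) (m.contDiff_ref ν K ξ)
  · rintro ⟨x, -, hx⟩
    by_cases h : K.node = n.node ∧ n.simplex ⊆ K.cell
    · rw [← h.1]
      exact DualCell.hex_subset_dualCell K
    · exact absurd (congrFun (n.field_eq_zero ν K ξ h) x) hx
  · rintro ⟨x, -, hx⟩
    by_cases h : K.cell = m.cell ∧ K.node ∈ m.core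
    · rw [← h.1]
      exact DualCell.hex_subset_convexHull ν K
    · exact absurd (congrFun (m.field_eq_zero ν K ξ h) x) hx
  · exact fun m n h => DualCell.curlH_eq_zero_of_disjoint ν ξ h
  · exact DualCell.encard_row_le ν ξ
  · exact DualCell.encard_column_le ν ξ
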